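/- **Setting.** Let $D\ge 1$ be an integer and $\alpha>D$ real. Let $\Lambda$ be the finite vertex set of a connected graph with shortest-path distance $d_{i,i'}$; write $i[r]=\{j\in\Lambda: d_{i,j}\le r\}$ and $\partial i[r]=\{j\in\Lambda: d_{i,j}=r\}$. The graph is a $D$-dimensional lattice with constant $\gamma\ge1$, that is, $|i[r]|\le\gamma r^D$ and $|\partial i[r]|\le\gamma r^{D-1}$ for all $i\in\Lambda$ and all integers $r\ge1$. A spin $1/2$ sits at each vertex. Let $H=\sum_{Z\subseteq\Lambda,\,|Z|\le k}h_Z$, where $h_Z$ is Hermitian and acts on the spins in $Z$ only, and $$\sum_{Z\supseteq\{i,i'\}}\|h_Z\|\le J_0\,(d_{i,i'}+1)^{-\alpha}\qquad\text{for all } i,i'\in\Lambda ,$$ with $\|\cdot\|$ the operator norm. Put $W(t)=e^{iHt}We^{-iHt}$ and $\|O\|_F=\sqrt{\mathrm{tr}(O^\dagger O)/\mathrm{tr}(\hat 1)}$. Let $\lambda$ be such that $\sum_{j\in\Lambda}(d_{i,j}+1)^{-\alpha}(d_{j,i'}+1)^{-\alpha}\le\lambda(d_{i,i'}+1)^{-\alpha}$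 for all $i,i'\in\Lambda$. Let $g$ be such that, for each site $i$, the absolute values of the coefficients of all Pauli products acting nontrivially at $i$ in the Pauli expansions of the terms $h_Z$ with $Z\ni i$ sum to at most $g$. Let $J=3^{k/2}J_0$ if each $h_Z$ is a combination of the $3^{|Z|}$ Pauli products that are nontrivial exactly at the sites of $Z$, and $J=4^{k/2}J_0$ otherwise. Put $\tilde g=\max(gk,\lambda J)$ and $$C_0=\frac{2^{\alpha-D/2+2}J_0\gamma}{2\alpha-D-1}+\frac{80\,\tilde g\,\gamma\,2^{\alpha-D/2}}{\alpha-D}\sqrt{2\alpha-2D+\gamma}.$$ **Theorem 1.** 1. Let $t>0$ and $\Delta t>0$ with $2e\tilde g\,\Delta t<1$ and $t/\Delta t\in\mathbb N$, and let $R\ge1$ be an integer multiple of $t/\Delta t$. For each $i\in\Lambda$ and each operator $W_i$ on the site $i$ with $\|W_i\|=1$ there is an operator $\tilde W_{i[R]}$ supported on $i[R]$ such that $$\|W_i(t)-\tilde W_{i[R]}\|_F\le 2^{D-1}C_0\,(\Delta t)^{-\alpha+\frac{D+1}2}\,t^{\alpha-\frac{D-1}2}\,R^{-\alpha+D}.$$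 2. Let $d_{i,i'}=R\ge1$, let $W_i$ and $V_{i'}$ be operators on the sites $i$ and $i'$ with $\|W_i\|=\|V_{i'}\|=1$, and let $C(R,t)=\mathrm{tr}\big([W_i(t),V_{i'}]^\dagger[W_i(t),V_{i'}]\big)/\mathrm{tr}(\hat1)$ be the out-of-time-order correlator. Then $C(R,t)\le4\,\|W_i(t)-W'\|_F^2$ for all real $t$ and every operator $W'$ supported on $i[R-1]$. 3. For every $t_0>0$ there are constants $C,C'>0$ that depend only on $D,\alpha,\gamma,k,J_0,t_0$ such that for all systems as above, all $t\ge t_0$, all $i$ and all $W_i$ with $\|W_i\|=1$: for each integer $r\ge1$ there is an operator $W'$ supported on $i[r]$ with $$\|W_i(t)-W'\|_F\le C\,r^{-\alpha+D}\,t^{\alpha-\frac{D-1}2},$$ and for every $V_{i'}$ with $\|V_{i'}\|=1$ and $d_{i,i'}=R\ge1$, $$C(R,t)\le\left(\frac{C't}{R^{\frac{2\alpha-2D}{2\alpha-D+1}}}\right)^{\alpha-\frac{D-1}2}.$$ -/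

import Mathlib

noncomputable section

namespace LongRange

open scoped Matrix

/-- Operators on the Hilbert space `(ℂ²)^{⊗Λ}` of spins `1/2` on the sites `Λ`, as matrices in the
product basis, which is labelled by the configurations `Λ → Fin 2`. -/
abbrev Op (Λ : Type*) := Matrix (Λ → Fin 2) (Λ → Fin 2) ℂ

section Lattice

variable {Λ : Type*} [Fintype Λ]

/-- The ball `i[r]` for the shortest-path distance. -/
def ball (G : SimpleGraph Λ) (i : Λ) (r : ℕ) : Finset Λ :=
  Finset.univ.filter fun j => G.dist i j ≤ r

/-- The surface `∂(i[r])` of the ball `i[r]`: the sites at distance exactly `r` from `i`. -/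
def sphere (G : SimpleGraph Λ) (i : Λ) (r : ℕ) : Finset Λ :=
  Finset.univ.filter fun j => G.dist i j = r

/-- The graph `G` is a `D`-dimensional lattice with lattice constant `γ`. -/
structure IsLattice (G : SimpleGraph Λ) (D : ℕ) (γ : ℝ) : Prop where
  connected : G.Connected
  one_le : 1 ≤ γ
  card_ball : ∀ (i : Λ) (r : ℕ), 1 ≤ r → ((ball G i r).card : ℝ) ≤ γ * (r : ℝ) ^ D
  card_sphere : ∀ (i : Λ) (r : ℕ), 1 ≤ r → ((sphere G i r).card : ℝ) ≤ γ * (r : ℝ) ^ (D - 1)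

end Lattice

section Operators

variable {Λ : Type*} [Fintype Λ] [DecidableEq Λ]

/-- The operator norm with respect to the Hermitian inner product. -/
def opNorm (A : Op Λ) : ℝ := ‖Matrix.toEuclideanCLM (n := Λ → Fin 2) (𝕜 := ℂ) A‖

/-- The normalized trace `tr(A) / tr(1)`. -/
def ntr (A : Op Λ) : ℂ := Matrix.trace A / Matrix.trace (1 : Op Λ)

/-- The normalized Frobenius norm `√(tr(A† A) / tr(1))`. -/
def frobNorm (A : Op Λ) : ℝ := Real.sqrt (ntr (Aᴴ * A)).re

/-- `A` acts on the spins in `X` only: `A = B ⊗ 1` with `B` an operator on the spins in `X` and `1`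
the identity on the other spins. -/
def SupportedOn (X : Finset Λ) (A : Op Λ) : Prop :=
  ∃ B : Op X, ∀ σ τ : Λ → Fin 2,
    A σ τ = if ∀ i, i ∉ X → σ i = τ i then B (fun i => σ i) (fun i => τ i) else 0

/-- The Heisenberg evolution `W(t) = e^{iHt} W e^{-iHt}`. -/
def evolve (H : Op Λ) (t : ℝ) (W : Op Λ) : Op Λ :=
  NormedSpace.exp ((Complex.I * (t : ℂ)) • H) * W * NormedSpace.exp ((-(Complex.I * (t : ℂ))) • H)

/-- The out-of-time-order correlator `tr([W(t), V]† [W(t), V]) / tr(1)`. -/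
def otoc (H : Op Λ) (t : ℝ) (W V : Op Λ) : ℝ :=
  (ntr ((evolve H t W * V - V * evolve H t W)ᴴ * (evolve H t W * V - V * evolve H t W))).re

/-- The matrices `1, σˣ, σʸ, σᶻ`. -/
def pauli : Fin 4 → Matrix (Fin 2) (Fin 2) ℂ :=
  ![1, !![0, 1; 1, 0], !![0, -Complex.I; Complex.I, 0], !![1, 0; 0, -1]]

/-- The product over all sites `i` of the Pauli matrix with label `p i` at `i`
(label `0` is the identity). -/
def pauliProd (p : Λ → Fin 4) : Op Λ := fun σ τ => ∏ i, pauli (p i) (σ i) (τ i)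

/-- The coefficient of the Pauli product `pauliProd p` in the Pauli expansion of `A`. -/
def pauliCoeff (p : Λ → Fin 4) (A : Op Λ) : ℂ := ntr (pauliProd p * A)

/-- `A` is a combination of the `3^|Z|` Pauli products that are different from the identity at each
site of `Z` and equal to the identity elsewhere. -/
def IsPauliSumOn (Z : Finset Λ) (A : Op Λ) : Prop :=
  A ∈ Submodule.span ℂ {P : Op Λ | ∃ p : Λ → Fin 4, (∀ i, p i ≠ 0 ↔ i ∈ Z) ∧ P = pauliProd p}

end Operators

section Hamiltonian

variable {Λ : Type*} [Fintype Λ] [DecidableEq Λ]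

/-- The Hamiltonian `H = ∑_Z h_Z`. -/
def hamiltonian (h : Finset Λ → Op Λ) : Op Λ := ∑ Z, h Z

/-- The terms `h_Z` define a `k`-local Hamiltonian whose interactions decay with the power `α`:
`∑_{Z ⊇ {i, i'}} ‖h_Z‖ ≤ J₀ (d_{i,i'} + 1)^{-α}` for all sites `i, i'`. -/
structure IsPowerLaw (G : SimpleGraph Λ) (h : Finset Λ → Op Λ) (k : ℕ) (α J₀ : ℝ) : Prop where
  hermitian : ∀ Z, (h Z).IsHermitian
  supported : ∀ Z, SupportedOn Z (h Z)
  klocal : ∀ Z, k < Z.card → h Z = 0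
  decay : ∀ i i' : Λ, ∑ Z ∈ Finset.univ.filter (fun Z : Finset Λ => i ∈ Z ∧ i' ∈ Z), opNorm (h Z)
    ≤ J₀ * ((G.dist i i' : ℝ) + 1) ^ (-α)

/-- `lam` is a constant for which the power law reproduces itself under convolution. -/
def IsConvConst (G : SimpleGraph Λ) (α lam : ℝ) : Prop :=
  ∀ i i' : Λ, ∑ j, ((G.dist i j : ℝ) + 1) ^ (-α) * ((G.dist j i' : ℝ) + 1) ^ (-α)
    ≤ lam * ((G.dist i i' : ℝ) + 1) ^ (-α)

/-- `g` bounds the one-site energies: for each site `i`, the absolute values of the coefficients of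
the Pauli products that act at `i`, over all terms `h_Z` with `i ∈ Z`, sum to at most `g`. -/
def IsSiteEnergy (h : Finset Λ → Op Λ) (g : ℝ) : Prop :=
  ∀ i : Λ, ∑ Z ∈ Finset.univ.filter (fun Z : Finset Λ => i ∈ Z),
    ∑ p ∈ Finset.univ.filter (fun p : Λ → Fin 4 => p i ≠ 0), ‖pauliCoeff p (h Z)‖ ≤ g

open Classical in
/-- The number of Pauli matrices needed per site in the Pauli expansion of the terms `h_Z`: three if
each `h_Z` is a combination of the `3^|Z|` Pauli products that are nontrivial at each site of `Z`,
and four (the identity included) otherwise. -/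
def pauliBase (h : Finset Λ → Op Λ) : ℝ := if ∀ Z, IsPauliSumOn Z (h Z) then 3 else 4

/-- `g̃ = max (g k, λ J)` with `J = 3^{k/2} J₀`, or `J = 4^{k/2} J₀` if some `h_Z` is not a
combination of Pauli products that are nontrivial at each site of `Z`. -/
def gTilde (h : Finset Λ → Op Λ) (k : ℕ) (J₀ lam g : ℝ) : ℝ :=
  max (g * k) (lam * (pauliBase h ^ ((k : ℝ) / 2) * J₀))

end Hamiltonian

/-- The constant `C₀`; `gt` stands for `g̃`. -/
def C₀ (D : ℕ) (α γ J₀ gt : ℝ) : ℝ :=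
  (2 : ℝ) ^ (α - (D : ℝ) / 2 + 2) * J₀ * γ / (2 * α - D - 1)
    + 80 * gt * γ * (2 : ℝ) ^ (α - (D : ℝ) / 2) / (α - D) * Real.sqrt (2 * α - 2 * D + γ)

end LongRange

end

open LongRange

universe u

/-
Keeping only the Pauli products that act inside a set `Y` is the orthogonal projection onto the
operators on `Y` for the inner product `tr (A† B) / tr 1`, and it is an average of unitary
conjugations, hence a contraction in operator norm. Let an operator on a ball `X` evolve for a
short time step, in the interaction picture that removes the part of `H` acting off `X`.
Differentiating the squared Frobenius norm of the part off a larger ball `Y` shows that this part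
grows only through the Pauli products of the evolved perturbation that leave `Y`. A Lieb-Robinson
series, which converges since `2 e g̃ Δt < 1`, bounds the weight of these products at a pair of
sites `i ∈ X`, `j ∉ Y` by a multiple of `(d(i, j) + 1)^(-α)`, the decay being reproduced by
convolution. In Frobenius norm it is the squares of these weights that add up, which gains a
square root over an operator norm estimate. Dividing `t` into `m = t / Δt` steps, each of which
enlarges the ball by `R / m`, and adding up the `m` errors gives the first claim. The second
holds because an operator on `i[R - 1]` commutes with `V_{i'}`, and the third follows by choosing
the step between two uniform bounds.
-/

noncomputable section

namespace LongRange

open Finset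
open scoped Matrix

section Tensor

variable {Λ : Type*} [Fintype Λ]

/-- The tensor product of the one-site operators `M i`. -/
def tensor (M : Λ → Matrix (Fin 2) (Fin 2) ℂ) : Op Λ := fun σ τ => ∏ i, M i (σ i) (τ i)

lemma pauliProd_eq_tensor (p : Λ → Fin 4) : pauliProd p = tensor fun i => pauli (p i) := rfl

lemma tensor_smul (z : Λ → ℂ) (M : Λ → Matrix (Fin 2) (Fin 2) ℂ) :
    tensor (fun i => z i • M i) = (∏ i, z i) • tensor M := by
  ext σ τ
  simp [tensor, prod_mul_distrib]

lemma conjTranspose_tensor (M : Λ → Matrix (Fin 2) (Fin 2) ℂ) :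
    (tensor M)ᴴ = tensor fun i => (M i)ᴴ := by
  ext σ τ
  simp [tensor, Matrix.conjTranspose_apply]

lemma tensor_one : tensor (fun _ : Λ => (1 : Matrix (Fin 2) (Fin 2) ℂ)) = 1 := by
  ext σ τ
  simp [tensor, Matrix.one_apply, prod_ite_zero, funext_iff]

variable [DecidableEq Λ]

lemma tensor_mul_tensor (M N : Λ → Matrix (Fin 2) (Fin 2) ℂ) :
    tensor M * tensor N = tensor fun i => M i * N i := by
  ext σ τ
  simp only [tensor, Matrix.mul_apply, ← prod_mul_distrib, prod_univ_sum, Fintype.piFinset_univ]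

lemma trace_tensor (M : Λ → Matrix (Fin 2) (Fin 2) ℂ) : (tensor M).trace = ∏ i, (M i).trace := by
  simp only [Matrix.trace, Matrix.diag, tensor, prod_univ_sum, Fintype.piFinset_univ]

lemma sum_piFinset_tensor {κ : Type*} (s : Λ → Finset κ)
    (M : Λ → κ → Matrix (Fin 2) (Fin 2) ℂ) :
    ∑ q ∈ Fintype.piFinset s, tensor (fun i => M i (q i)) = tensor fun i => ∑ a ∈ s i, M i a := by
  ext σ τ
  simp only [tensor, Matrix.sum_apply, prod_univ_sum]

lemma trace_one_op : (1 : Op Λ).trace = 2 ^ Fintype.card Λ := by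
  simp [← tensor_one, trace_tensor]

end Tensor

section Pauli

/-- The label of the product of two Pauli matrices, up to a phase: addition in the Klein
four-group. -/
def pauliMul : Fin 4 → Fin 4 → Fin 4 :=
  ![![0, 1, 2, 3], ![1, 0, 3, 2], ![2, 3, 0, 1], ![3, 2, 1, 0]]

/-- The phase in the product of two Pauli matrices. -/
def pauliPhase : Fin 4 → Fin 4 → ℂ :=
  ![![1, 1, 1, 1], ![1, 1, Complex.I, -Complex.I], ![1, -Complex.I, 1, Complex.I],
    ![1, Complex.I, -Complex.I, 1]]

lemma pauliMul_zero_left (b : Fin 4) : pauliMul 0 b = b := by revert b; decide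

lemma pauliMul_self (a : Fin 4) : pauliMul a a = 0 := by revert a; decide

lemma pauliMul_eq_zero_iff {a b : Fin 4} : pauliMul a b = 0 ↔ a = b := by revert a b; decide

lemma pauliPhase_self (a : Fin 4) : pauliPhase a a = 1 := by fin_cases a <;> rfl

lemma norm_pauliPhase (a b : Fin 4) : ‖pauliPhase a b‖ = 1 := by
  fin_cases a <;> fin_cases b <;> simp [pauliPhase]

lemma pauli_zero : pauli 0 = 1 := rfl

lemma pauli_mul (a b : Fin 4) : pauli a * pauli b = pauliPhase a b • pauli (pauliMul a b) := by
  fin_cases a <;> fin_cases b <;> ext x y <;> fin_cases x <;> fin_cases y <;>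
    simp [pauli, pauliPhase, pauliMul, Matrix.mul_apply, Fin.sum_univ_two]

lemma pauli_mul_self (a : Fin 4) : pauli a * pauli a = 1 := by
  rw [pauli_mul, pauliMul_self, pauliPhase_self, one_smul, pauli_zero]

lemma conjTranspose_pauli (a : Fin 4) : (pauli a)ᴴ = pauli a := by
  fin_cases a <;> ext x y <;> fin_cases x <;> fin_cases y <;>
    simp [pauli, Matrix.conjTranspose_apply]

lemma trace_pauli (a : Fin 4) : (pauli a).trace = if a = 0 then 2 else 0 := by
  fin_cases a <;> simp [pauli, Matrix.trace, Fin.sum_univ_two]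

lemma sum_pauli_conj (a : Fin 4) :
    ∑ b, pauli b * pauli a * pauli b = if a = 0 then (4 : ℂ) • 1 else 0 := by
  fin_cases a <;> ext x y <;> fin_cases x <;> fin_cases y <;>
    simp [pauli, Fin.sum_univ_four] <;> norm_num

lemma sum_pauli_apply_mul_pauli_apply (x y z w : Fin 2) :
    ∑ a, pauli a z w * pauli a x y = if x = w ∧ y = z then 2 else 0 := by
  fin_cases x <;> fin_cases y <;> fin_cases z <;> fin_cases w <;>
    simp [pauli, Fin.sum_univ_four] <;> norm_num

end Pauli

section PauliProduct

variable {Λ : Type*} [Fintype Λ]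

/-- The label of the product of two Pauli products, up to a phase. -/
def pauliProdMul (p q : Λ → Fin 4) : Λ → Fin 4 := fun i => pauliMul (p i) (q i)

lemma norm_prod_pauliPhase (p q : Λ → Fin 4) : ‖∏ i, pauliPhase (p i) (q i)‖ = 1 := by
  simp [norm_pauliPhase]

lemma conjTranspose_pauliProd (p : Λ → Fin 4) : (pauliProd p)ᴴ = pauliProd p := by
  simp only [pauliProd_eq_tensor, conjTranspose_tensor, conjTranspose_pauli]

variable [DecidableEq Λ]

lemma pauliProd_mul (p q : Λ → Fin 4) : pauliProd p * pauliProd q =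
    (∏ i, pauliPhase (p i) (q i)) • pauliProd (pauliProdMul p q) := by
  simp only [pauliProd_eq_tensor, tensor_mul_tensor, pauli_mul, tensor_smul, pauliProdMul]

lemma pauliProd_mul_self (p : Λ → Fin 4) : pauliProd p * pauliProd p = 1 := by
  simp only [pauliProd_eq_tensor, tensor_mul_tensor, pauli_mul_self, tensor_one]

lemma commute_pauliProd {p q : Λ → Fin 4} (h : ∀ i, p i = 0 ∨ q i = 0) :
    Commute (pauliProd p) (pauliProd q) := by
  simp only [Commute, SemiconjBy, pauliProd_eq_tensor, tensor_mul_tensor]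
  congr 1
  funext i
  rcases h i with h | h <;> simp [h, pauli_zero]

lemma sum_pauliProd_apply_mul_pauliProd_apply (σ τ σ' τ' : Λ → Fin 2) :
    ∑ p : Λ → Fin 4, pauliProd p σ' τ' * pauliProd p σ τ =
      if σ = τ' ∧ τ = σ' then (2 : ℂ) ^ Fintype.card Λ else 0 := by
  simp only [pauliProd, ← prod_mul_distrib]
  rw [← Fintype.piFinset_univ,
    ← prod_univ_sum (fun _ => univ) (fun i a => pauli a (σ' i) (τ' i) * pauli a (σ i) (τ i))]
  simp [sum_pauli_apply_mul_pauli_apply, prod_ite_zero, funext_iff, forall_and]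

lemma ntr_add (A B : Op Λ) : ntr (A + B) = ntr A + ntr B := by
  simp [ntr, Matrix.trace_add, add_div]

lemma ntr_smul (z : ℂ) (A : Op Λ) : ntr (z • A) = z * ntr A := by
  simp [ntr, Matrix.trace_smul, mul_div_assoc]

lemma ntr_pauliProd (p : Λ → Fin 4) : ntr (pauliProd p) = if p = 0 then 1 else 0 := by
  rw [ntr, trace_one_op, pauliProd_eq_tensor, trace_tensor]
  simp only [trace_pauli, prod_ite_zero, funext_iff, Pi.zero_apply]
  split_ifs <;> simp_all

end PauliProduct

section PauliExpansion

variable {Λ : Type*} [Fintype Λ] [DecidableEq Λ]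

/-- The coefficient of `pauliProd p` in the Pauli expansion, as a linear functional. -/
def pauliCoeffₗ (p : Λ → Fin 4) : Op Λ →ₗ[ℂ] ℂ where
  toFun := pauliCoeff p
  map_add' A B := by simp [pauliCoeff, Matrix.mul_add, ntr_add]
  map_smul' z A := by simp [pauliCoeff, ntr_smul]

lemma pauliCoeff_zero (p : Λ → Fin 4) : pauliCoeff p (0 : Op Λ) = 0 := (pauliCoeffₗ p).map_zero

lemma pauliCoeff_add (p : Λ → Fin 4) (A B : Op Λ) :
    pauliCoeff p (A + B) = pauliCoeff p A + pauliCoeff p B := (pauliCoeffₗ p).map_add A B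

lemma pauliCoeff_sub (p : Λ → Fin 4) (A B : Op Λ) :
    pauliCoeff p (A - B) = pauliCoeff p A - pauliCoeff p B := (pauliCoeffₗ p).map_sub A B

lemma pauliCoeff_smul (p : Λ → Fin 4) (z : ℂ) (A : Op Λ) :
    pauliCoeff p (z • A) = z * pauliCoeff p A := (pauliCoeffₗ p).map_smul z A

lemma pauliCoeff_sum {ι : Type*} (p : Λ → Fin 4) (s : Finset ι) (A : ι → Op Λ) :
    pauliCoeff p (∑ j ∈ s, A j) = ∑ j ∈ s, pauliCoeff p (A j) := map_sum (pauliCoeffₗ p) A s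

lemma pauliCoeff_pauliProd (p q : Λ → Fin 4) :
    pauliCoeff p (pauliProd q) = if p = q then 1 else 0 := by
  have h : pauliProdMul p q = 0 ↔ p = q := by
    simp [funext_iff, pauliProdMul, pauliMul_eq_zero_iff]
  rw [pauliCoeff, pauliProd_mul, ntr_smul, ntr_pauliProd, ite_congr (propext h)
    (fun _ => rfl) fun _ => rfl]
  split_ifs with hpq
  · simp [hpq, pauliPhase_self]
  · simp

lemma pauliCoeff_sum_smul_pauliProd (p : Λ → Fin 4) (s : Finset (Λ → Fin 4))
    (c : (Λ → Fin 4) → ℂ) :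
    pauliCoeff p (∑ q ∈ s, c q • pauliProd q) = if p ∈ s then c p else 0 := by
  simp [pauliCoeff_sum, pauliCoeff_smul, pauliCoeff_pauliProd]

lemma sum_pauliCoeff_smul_pauliProd (A : Op Λ) : ∑ p, pauliCoeff p A • pauliProd p = A := by
  have h2 : (2 : ℂ) ^ Fintype.card Λ ≠ 0 := pow_ne_zero _ two_ne_zero
  ext σ τ
  simp only [Matrix.sum_apply, Matrix.smul_apply, smul_eq_mul, pauliCoeff, ntr, trace_one_op]
  simp only [Matrix.trace, Matrix.diag, Matrix.mul_apply]
  calc ∑ p : Λ → Fin 4, (∑ σ', ∑ τ', pauliProd p σ' τ' * A τ' σ') / 2 ^ Fintype.card Λ *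
        pauliProd p σ τ
      = ∑ σ', ∑ τ', (∑ p : Λ → Fin 4, pauliProd p σ' τ' * pauliProd p σ τ) *
          A τ' σ' / 2 ^ Fintype.card Λ := by
        simp only [sum_div, sum_mul]
        rw [sum_comm]
        refine sum_congr rfl fun σ' _ => ?_
        rw [sum_comm]
        refine sum_congr rfl fun τ' _ => sum_congr rfl fun p _ => by ring
    _ = A σ τ := by
        simp [sum_pauliProd_apply_mul_pauliProd_apply, ite_and, ite_mul, ite_div, h2]

lemma ext_pauliCoeff {A B : Op Λ} (h : ∀ p, pauliCoeff p A = pauliCoeff p B) : A = B := by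
  rw [← sum_pauliCoeff_smul_pauliProd A, ← sum_pauliCoeff_smul_pauliProd B]
  simp only [h]

lemma pauliCoeff_conjTranspose (p : Λ → Fin 4) (A : Op Λ) :
    pauliCoeff p Aᴴ = star (pauliCoeff p A) := by
  conv_lhs => rw [← sum_pauliCoeff_smul_pauliProd A]
  simp only [Matrix.conjTranspose_sum, Matrix.conjTranspose_smul, conjTranspose_pauliProd]
  simpa using pauliCoeff_sum_smul_pauliProd p univ fun q => star (pauliCoeff q A)

end PauliExpansion

section Support

variable {Λ : Type*} [Fintype Λ]

/-- The set of sites at which a Pauli product is different from the identity. -/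
def pauliSupp (p : Λ → Fin 4) : Finset Λ := univ.filter fun i => p i ≠ 0

lemma mem_pauliSupp {p : Λ → Fin 4} {i : Λ} : i ∈ pauliSupp p ↔ p i ≠ 0 := by simp [pauliSupp]

variable [DecidableEq Λ]

/-- A Pauli label on `X`, extended to all sites by the label of the identity. -/
def extendLabel (X : Finset Λ) (q : X → Fin 4) : Λ → Fin 4 :=
  fun i => if h : i ∈ X then q ⟨i, h⟩ else 0

lemma extendLabel_restrict {X : Finset Λ} {p : Λ → Fin 4} (h : pauliSupp p ⊆ X) :
    extendLabel X (fun i => p i) = p := by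
  funext i
  by_cases hi : i ∈ X
  · simp [extendLabel, hi]
  · simpa [extendLabel, hi, mem_pauliSupp, eq_comm] using mt (@h i) hi

lemma pauliSupp_extendLabel_subset (X : Finset Λ) (q : X → Fin 4) :
    pauliSupp (extendLabel X q) ⊆ X := by
  intro i hi
  by_contra h
  exact mem_pauliSupp.1 hi (by simp [extendLabel, h])

lemma pauliProd_extendLabel_apply (X : Finset Λ) (q : X → Fin 4) (σ τ : Λ → Fin 2) :
    pauliProd (extendLabel X q) σ τ =
      if ∀ i, i ∉ X → σ i = τ i then pauliProd q (fun i => σ i) (fun i => τ i) else 0 := by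
  have inside : ∏ i ∈ X, pauli (extendLabel X q i) (σ i) (τ i) =
      pauliProd q (fun i => σ i) (fun i => τ i) := by
    rw [pauliProd, ← prod_coe_sort]
    exact prod_congr rfl fun i _ => by simp [extendLabel]
  have outside : ∏ i ∈ Xᶜ, pauli (extendLabel X q i) (σ i) (τ i) =
      if ∀ i, i ∉ X → σ i = τ i then 1 else 0 := by
    have h_one : ∀ i ∈ Xᶜ, pauli (extendLabel X q i) (σ i) (τ i) = if σ i = τ i then 1 else 0 :=
      fun i hi => by simp [extendLabel, mem_compl.1 hi, pauli_zero, Matrix.one_apply]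
    simp [prod_congr rfl h_one, prod_ite_zero]
  rw [pauliProd, ← prod_mul_prod_compl X, inside, outside]
  split_ifs <;> simp

/-- The operators supported on `X`, as a subspace. -/
def supportSubmodule (X : Finset Λ) : Submodule ℂ (Op Λ) where
  carrier := {A | SupportedOn X A}
  zero_mem' := ⟨0, by simp⟩
  add_mem' := by
    rintro A A' ⟨B, hB⟩ ⟨B', hB'⟩
    refine ⟨B + B', fun σ τ => ?_⟩
    rw [Matrix.add_apply, hB, hB']
    split_ifs <;> simp
  smul_mem' := by
    rintro z A ⟨B, hB⟩
    refine ⟨z • B, fun σ τ => ?_⟩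
    rw [Matrix.smul_apply, hB]
    split_ifs <;> simp

lemma mem_supportSubmodule {X : Finset Λ} {A : Op Λ} :
    A ∈ supportSubmodule X ↔ SupportedOn X A := Iff.rfl

lemma supportedOn_zero (X : Finset Λ) : SupportedOn X (0 : Op Λ) := (supportSubmodule X).zero_mem

lemma supportedOn_pauliProd {X : Finset Λ} {p : Λ → Fin 4} (h : pauliSupp p ⊆ X) :
    SupportedOn X (pauliProd p) :=
  ⟨pauliProd fun i => p i, fun σ τ => by
    rw [← pauliProd_extendLabel_apply, extendLabel_restrict h]⟩

lemma SupportedOn.pauliCoeff_eq_zero {X : Finset Λ} {A : Op Λ} (hA : SupportedOn X A)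
    {p : Λ → Fin 4} (hp : ¬ pauliSupp p ⊆ X) : pauliCoeff p A = 0 := by
  obtain ⟨B, hB⟩ := hA
  have expansion : A = ∑ q : X → Fin 4, pauliCoeff q B • pauliProd (extendLabel X q) := by
    ext σ τ
    rw [hB, Matrix.sum_apply]
    simp only [Matrix.smul_apply, pauliProd_extendLabel_apply]
    split_ifs
    · conv_lhs => rw [← sum_pauliCoeff_smul_pauliProd B]
      simp [Matrix.sum_apply]
    · simp
  rw [expansion, pauliCoeff_sum]
  refine sum_eq_zero fun q _ => ?_
  rw [pauliCoeff_smul, pauliCoeff_pauliProd, if_neg, mul_zero]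
  rintro rfl
  exact hp (pauliSupp_extendLabel_subset X q)

lemma supportedOn_iff_pauliCoeff_eq_zero {X : Finset Λ} {A : Op Λ} :
    SupportedOn X A ↔ ∀ p, ¬ pauliSupp p ⊆ X → pauliCoeff p A = 0 := by
  refine ⟨fun hA p => hA.pauliCoeff_eq_zero, fun h => ?_⟩
  rw [← mem_supportSubmodule, ← sum_pauliCoeff_smul_pauliProd A]
  refine Submodule.sum_mem _ fun p _ => ?_
  by_cases hp : pauliSupp p ⊆ X
  · exact Submodule.smul_mem _ _ (supportedOn_pauliProd hp)
  · simp [h p hp]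

lemma SupportedOn.mono {X Y : Finset Λ} {A : Op Λ} (hA : SupportedOn X A) (hXY : X ⊆ Y) :
    SupportedOn Y A :=
  supportedOn_iff_pauliCoeff_eq_zero.2 fun _ hp =>
    hA.pauliCoeff_eq_zero fun h => hp (h.trans hXY)

lemma SupportedOn.commute {X Y : Finset Λ} {A B : Op Λ} (hA : SupportedOn X A)
    (hB : SupportedOn Y B) (hXY : Disjoint X Y) : Commute A B := by
  rw [← sum_pauliCoeff_smul_pauliProd A, ← sum_pauliCoeff_smul_pauliProd B]
  refine Commute.sum_left _ _ _ fun p _ => Commute.sum_right _ _ _ fun q _ => ?_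
  by_cases hp : pauliSupp p ⊆ X
  · by_cases hq : pauliSupp q ⊆ Y
    · refine ((commute_pauliProd fun i => ?_).smul_left _).smul_right _
      by_contra! h
      exact disjoint_left.1 hXY (hp (mem_pauliSupp.2 h.1)) (hq (mem_pauliSupp.2 h.2))
    · simp [hB.pauliCoeff_eq_zero hq]
  · simp [hA.pauliCoeff_eq_zero hp]

end Support

attribute [local instance] LieRing.ofAssociativeRing

section FrobeniusNorm

variable {Λ : Type*} [Fintype Λ] [DecidableEq Λ]

/-- The vector of the Pauli coefficients, which turns the inner product
`(A, B) ↦ tr (A† B) / tr 1` into that of a Euclidean space. -/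
def pauliVec : Op Λ →ₗ[ℂ] EuclideanSpace ℂ (Λ → Fin 4) where
  toFun A := WithLp.toLp 2 fun p => pauliCoeff p A
  map_add' A B := by ext p; simp [pauliCoeff_add]
  map_smul' z A := by ext p; simp [pauliCoeff_smul]

lemma pauliVec_apply (A : Op Λ) (p : Λ → Fin 4) : pauliVec A p = pauliCoeff p A := rfl

lemma inner_pauliVec (A B : Op Λ) : inner ℂ (pauliVec A) (pauliVec B) = ntr (Aᴴ * B) := by
  rw [← sum_pauliCoeff_smul_pauliProd Aᴴ, sum_mul, ntr, Matrix.trace_sum, sum_div,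
    PiLp.inner_apply]
  refine sum_congr rfl fun p _ => ?_
  rw [← ntr, Matrix.smul_mul, ntr_smul, ← pauliCoeff, pauliCoeff_conjTranspose]
  simp [pauliVec_apply, mul_comm]

lemma frobNorm_eq_norm_pauliVec (A : Op Λ) : frobNorm A = ‖pauliVec A‖ := by
  rw [frobNorm, norm_eq_sqrt_re_inner (𝕜 := ℂ), inner_pauliVec]
  rfl

lemma frobNorm_sq (A : Op Λ) : frobNorm A ^ 2 = ∑ p, ‖pauliCoeff p A‖ ^ 2 := by
  rw [frobNorm_eq_norm_pauliVec, EuclideanSpace.norm_sq_eq]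
  rfl

lemma frobNorm_nonneg (A : Op Λ) : 0 ≤ frobNorm A := Real.sqrt_nonneg _

lemma frobNorm_zero : frobNorm (0 : Op Λ) = 0 := by simp [frobNorm_eq_norm_pauliVec]

lemma frobNorm_add_le (A B : Op Λ) : frobNorm (A + B) ≤ frobNorm A + frobNorm B := by
  simp only [frobNorm_eq_norm_pauliVec, map_add, norm_add_le]

lemma frobNorm_sub_le (A B : Op Λ) : frobNorm (A - B) ≤ frobNorm A + frobNorm B := by
  simp only [frobNorm_eq_norm_pauliVec, map_sub, norm_sub_le]

lemma frobNorm_conjTranspose (A : Op Λ) : frobNorm Aᴴ = frobNorm A := by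
  rw [← sq_eq_sq₀ (frobNorm_nonneg _) (frobNorm_nonneg _), frobNorm_sq, frobNorm_sq]
  simp only [pauliCoeff_conjTranspose, norm_star]

lemma frobNorm_sq_eq_sum_entries (A : Op Λ) :
    frobNorm A ^ 2 = (∑ τ, ∑ σ, ‖A σ τ‖ ^ 2) / 2 ^ Fintype.card Λ := by
  have h : ntr (Aᴴ * A) = (((∑ τ, ∑ σ, ‖A σ τ‖ ^ 2) / 2 ^ Fintype.card Λ : ℝ) : ℂ) := by
    rw [ntr, trace_one_op]
    push_cast
    simp only [Matrix.trace, Matrix.diag, Matrix.mul_apply, Matrix.conjTranspose_apply,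
      ← Complex.conj_mul', Complex.star_def]
  rw [frobNorm, h, Complex.ofReal_re, Real.sq_sqrt (by positivity)]

end FrobeniusNorm

section OperatorNorm

open scoped Matrix.Norms.L2Operator

variable {Λ : Type*} [Fintype Λ] [DecidableEq Λ]

lemma opNorm_eq_norm (A : Op Λ) : opNorm A = ‖A‖ := rfl

lemma opNorm_nonneg (A : Op Λ) : 0 ≤ opNorm A := norm_nonneg _

lemma opNorm_of_mem_unitary {U : Op Λ} (hU : U ∈ unitary (Op Λ)) : opNorm U = 1 :=
  CStarRing.norm_of_mem_unitary (E := Op Λ) hU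

lemma opNorm_mul_mem_unitary {U : Op Λ} (hU : U ∈ unitary (Op Λ)) (A : Op Λ) :
    opNorm (A * U) = opNorm A :=
  CStarRing.norm_mul_mem_unitary (E := Op Λ) A hU

lemma opNorm_mem_unitary_mul {U : Op Λ} (hU : U ∈ unitary (Op Λ)) (A : Op Λ) :
    opNorm (U * A) = opNorm A :=
  CStarRing.norm_mem_unitary_mul (E := Op Λ) A hU

lemma pauliProd_mem_unitary (p : Λ → Fin 4) : pauliProd p ∈ unitary (Op Λ) := by
  simp only [Unitary.mem_iff, Matrix.star_eq_conjTranspose, conjTranspose_pauliProd,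
    pauliProd_mul_self, and_self]

lemma frobNorm_mul_le_opNorm_mul (A B : Op Λ) : frobNorm (A * B) ≤ opNorm A * frobNorm B := by
  have hA := opNorm_nonneg A
  rw [← sq_le_sq₀ (frobNorm_nonneg _) (mul_nonneg hA (frobNorm_nonneg _)), mul_pow,
    frobNorm_sq_eq_sum_entries, frobNorm_sq_eq_sum_entries, mul_div_assoc', mul_sum]
  gcongr with τ _
  have column := pow_le_pow_left₀ (norm_nonneg _)
    (Matrix.l2_opNorm_mulVec A (WithLp.toLp 2 fun σ => B σ τ)) 2
  rwa [mul_pow, EuclideanSpace.norm_sq_eq, EuclideanSpace.norm_sq_eq] at column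

lemma frobNorm_mul_le_mul_opNorm (A B : Op Λ) : frobNorm (A * B) ≤ frobNorm A * opNorm B := by
  have h := frobNorm_mul_le_opNorm_mul Bᴴ Aᴴ
  rwa [← Matrix.conjTranspose_mul, frobNorm_conjTranspose, frobNorm_conjTranspose, opNorm_eq_norm,
    Matrix.l2_opNorm_conjTranspose, mul_comm] at h

lemma frobNorm_lie_le (A B : Op Λ) : frobNorm ⁅A, B⁆ ≤ 2 * frobNorm A * opNorm B := by
  have h := frobNorm_sub_le (A * B) (B * A)
  rw [← Ring.lie_def] at h
  linarith [frobNorm_mul_le_mul_opNorm A B, frobNorm_mul_le_opNorm_mul B A]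

lemma frobNorm_le_opNorm (A : Op Λ) : frobNorm A ≤ opNorm A := by
  have h_one : frobNorm (1 : Op Λ) = 1 := by
    simp [frobNorm, ntr]
  simpa [h_one] using frobNorm_mul_le_opNorm_mul A 1

end OperatorNorm

section BanachAlgebra

open NormedSpace (exp)

variable {𝔸 : Type*} [NormedRing 𝔸] [NormedAlgebra ℂ 𝔸]

/-- The commutator with `H` as a continuous linear map. -/
def adCLM (H : 𝔸) : 𝔸 →L[ℂ] 𝔸 :=
  ContinuousLinearMap.mul ℂ 𝔸 H - (ContinuousLinearMap.mul ℂ 𝔸).flip H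

lemma adCLM_apply (H A : 𝔸) : adCLM H A = ⁅H, A⁆ := rfl

lemma adCLM_pow_apply (H A : 𝔸) (n : ℕ) : (adCLM H ^ n) A = (fun B => ⁅H, B⁆)^[n] A := by
  induction n with
  | zero => rfl
  | succ n ih => rw [pow_succ', Function.iterate_succ_apply', ← ih]; rfl

variable [CompleteSpace 𝔸]

lemma exp_add_smul (x : 𝔸) (z w : ℂ) : exp ((z + w) • x) = exp (z • x) * exp (w • x) := by
  let _ : NormedAlgebra ℚ 𝔸 := NormedAlgebra.restrictScalars ℚ ℂ 𝔸
  rw [add_smul, NormedSpace.exp_add_of_commute (((Commute.refl x).smul_left z).smul_right w)]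

lemma exp_smul_mul_exp_neg_smul (x : 𝔸) (z : ℂ) : exp (z • x) * exp ((-z) • x) = 1 := by
  rw [← exp_add_smul, add_neg_cancel, zero_smul, NormedSpace.exp_zero]

lemma hasSum_exp_smul (x : 𝔸) (z : ℂ) :
    HasSum (fun n : ℕ => ((n.factorial : ℂ)⁻¹ * z ^ n) • x ^ n) (exp (z • x)) := by
  simpa only [smul_pow, smul_smul] using NormedSpace.exp_series_hasSum_exp' (𝕂 := ℂ) (z • x)

lemma hasDerivAt_exp_neg_smul (x : 𝔸) (z : ℂ) :
    HasDerivAt (fun u : ℂ => exp ((-u) • x)) (-(exp ((-z) • x) * x)) z := by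
  simpa only [neg_one_smul] using! (hasDerivAt_exp_smul_const x (-z)).scomp z (hasDerivAt_neg z)

lemma hasDerivAt_exp_smul_conj (H W : 𝔸) (z : ℂ) :
    HasDerivAt (fun u : ℂ => exp (u • H) * W * exp ((-u) • H))
      (adCLM H (exp (z • H) * W * exp ((-z) • H))) z := by
  convert! ((hasDerivAt_exp_smul_const' H z).mul_const W).mul (hasDerivAt_exp_neg_smul H z) using 1
  rw [adCLM_apply, Ring.lie_def]
  noncomm_ring

/-- Both sides solve `x' = [H, x]`, so `e^{-u ad H}` applied to the left-hand side is constant. -/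
lemma exp_smul_conj_eq_exp_adCLM (H W : 𝔸) (z : ℂ) :
    exp (z • H) * W * exp ((-z) • H) = exp (z • adCLM H) W := by
  have hd (u : ℂ) : HasDerivAt
      (fun u : ℂ => exp ((-u) • adCLM H) (exp (u • H) * W * exp ((-u) • H))) 0 u := by
    convert! (hasDerivAt_exp_neg_smul (adCLM H) u).clm_apply (hasDerivAt_exp_smul_conj H W u)
      using 1
    exact (neg_add_cancel _).symm
  have hconst : exp ((-z) • adCLM H) (exp (z • H) * W * exp ((-z) • H)) = W := by
    refine (is_const_of_deriv_eq_zero (fun u => (hd u).differentiableAt)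
      (fun u => (hd u).deriv) z 0).trans ?_
    simp only [neg_zero, zero_smul ℂ H, zero_smul ℂ (adCLM H), NormedSpace.exp_zero, one_mul,
      mul_one, one_apply_eq_self]
  calc exp (z • H) * W * exp ((-z) • H)
      = (exp (z • adCLM H) * exp ((-z) • adCLM H)) (exp (z • H) * W * exp ((-z) • H)) := by
        rw [exp_smul_mul_exp_neg_smul (adCLM H), one_apply_eq_self]
    _ = exp (z • adCLM H) W := by rw [mul_apply_eq_comp, hconst]

lemma hasDerivAt_exp_smul_sub_mul_exp_smul (x y : 𝔸) (t u : ℝ) :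
    HasDerivAt (fun v : ℝ =>
      exp ((Complex.I * (t - v : ℝ)) • x) * exp ((Complex.I * v) • y))
      (Complex.I • (exp ((Complex.I * (t - u : ℝ)) • x) * (y - x) * exp ((Complex.I * u) • y)))
      u := by
  have hx : HasDerivAt (fun v : ℝ => Complex.I * ((t - v : ℝ) : ℂ)) (-Complex.I) u := by
    simpa using (((hasDerivAt_id u).const_sub t).ofReal_comp).const_mul Complex.I
  have hy : HasDerivAt (fun v : ℝ => Complex.I * (v : ℂ)) Complex.I u := by
    simpa using ((hasDerivAt_id u).ofReal_comp).const_mul Complex.I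
  convert! ((hasDerivAt_exp_smul_const x _).scomp u hx).mul
    ((hasDerivAt_exp_smul_const' y _).scomp u hy) using 1
  simp only [Function.comp_apply, neg_smul, smul_mul_assoc, mul_smul_comm, neg_mul, mul_sub,
    sub_mul, smul_sub, mul_assoc]
  abel

end BanachAlgebra

section Evolution

open scoped Matrix.Norms.L2Operator

open NormedSpace (exp)

variable {Λ : Type*} [Fintype Λ] [DecidableEq Λ]

lemma evolve_eq_exp_adCLM (H : Op Λ) (t : ℝ) (W : Op Λ) :
    evolve H t W = exp ((Complex.I * t) • adCLM H) W := exp_smul_conj_eq_exp_adCLM _ _ _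

lemma evolve_zero (H W : Op Λ) : evolve H 0 W = W := by simp [evolve]

lemma evolve_add (H : Op Λ) (s t : ℝ) (W : Op Λ) :
    evolve H (s + t) W = evolve H s (evolve H t W) := by
  rw [evolve_eq_exp_adCLM, Complex.ofReal_add, mul_add, exp_add_smul (adCLM H),
    evolve_eq_exp_adCLM, evolve_eq_exp_adCLM]
  rfl

lemma evolve_map_sub (H : Op Λ) (t : ℝ) (A B : Op Λ) :
    evolve H t (A - B) = evolve H t A - evolve H t B := by
  simp only [evolve_eq_exp_adCLM, map_sub]

lemma evolve_map_mul (H : Op Λ) (t : ℝ) (A B : Op Λ) :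
    evolve H t (A * B) = evolve H t A * evolve H t B := by
  have h := exp_smul_mul_exp_neg_smul H (-(Complex.I * t))
  rw [neg_neg] at h
  simp only [evolve, mul_assoc]
  rw [← mul_assoc (exp (-(Complex.I * (t : ℂ)) • H)) (exp _), h, one_mul]

lemma evolve_map_lie (H : Op Λ) (t : ℝ) (A B : Op Λ) :
    evolve H t ⁅A, B⁆ = ⁅evolve H t A, evolve H t B⁆ := by
  simp only [Ring.lie_def, evolve_map_sub, evolve_map_mul]

lemma hasSum_evolve (H W : Op Λ) (t : ℝ) :
    HasSum (fun n : ℕ => ((n.factorial : ℂ)⁻¹ * (Complex.I * t) ^ n) • (fun A => ⁅H, A⁆)^[n] W)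
      (evolve H t W) := by
  rw [evolve_eq_exp_adCLM]
  simpa only [ContinuousLinearMap.apply_apply, smul_apply, adCLM_pow_apply] using!
    (hasSum_exp_smul (adCLM H) (Complex.I * t)).mapL (ContinuousLinearMap.apply ℂ (Op Λ) W)

lemma hasDerivAt_interaction (H H₀ W : Op Λ) (t u : ℝ) :
    HasDerivAt (fun v : ℝ => evolve H₀ (t - v) (evolve H v W))
      (Complex.I • ⁅evolve H₀ (t - u) (H - H₀), evolve H₀ (t - u) (evolve H u W)⁆) u := by
  have hW := ((ContinuousLinearMap.apply ℂ (Op Λ) W).restrictScalars ℝ).hasFDerivAt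
    (x := exp ((Complex.I * (t - u : ℝ)) • adCLM H₀) * exp ((Complex.I * u) • adCLM H))
  convert! hW.comp_hasDerivAt u
    (hasDerivAt_exp_smul_sub_mul_exp_smul (adCLM H₀) (adCLM H) t u) using 1
  · funext v
    rw [evolve_eq_exp_adCLM, evolve_eq_exp_adCLM]
    rfl
  · rw [← evolve_map_lie, evolve_eq_exp_adCLM, evolve_eq_exp_adCLM, sub_lie]
    simp [adCLM_apply]

variable {H : Op Λ}

lemma exp_I_mul_smul_mem_unitary (hH : H.IsHermitian) (t : ℝ) :
    exp ((Complex.I * t) • H) ∈ unitary (Op Λ) := by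
  let _ : NormedAlgebra ℚ (Op Λ) := NormedAlgebra.restrictScalars ℚ ℂ (Op Λ)
  refine NormedSpace.exp_mem_unitary_of_mem_skewAdjoint ?_
  simp [skewAdjoint.mem_iff, Matrix.star_eq_conjTranspose, hH.eq]

lemma exp_neg_I_mul_smul_mem_unitary (hH : H.IsHermitian) (t : ℝ) :
    exp ((-(Complex.I * t)) • H) ∈ unitary (Op Λ) := by
  simpa using exp_I_mul_smul_mem_unitary hH (-t)

lemma opNorm_evolve (hH : H.IsHermitian) (t : ℝ) (W : Op Λ) :
    opNorm (evolve H t W) = opNorm W := by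
  rw [evolve, opNorm_mul_mem_unitary (exp_neg_I_mul_smul_mem_unitary hH t),
    opNorm_mem_unitary_mul (exp_I_mul_smul_mem_unitary hH t)]

lemma frobNorm_evolve_le (hH : H.IsHermitian) (t : ℝ) (W : Op Λ) :
    frobNorm (evolve H t W) ≤ frobNorm W := by
  have hl := frobNorm_mul_le_opNorm_mul (exp ((Complex.I * t) • H)) W
  rw [opNorm_of_mem_unitary (exp_I_mul_smul_mem_unitary hH t), one_mul] at hl
  have hr := frobNorm_mul_le_mul_opNorm (exp ((Complex.I * t) • H) * W)
    (exp ((-(Complex.I * t)) • H))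
  rw [opNorm_of_mem_unitary (exp_neg_I_mul_smul_mem_unitary hH t), mul_one] at hr
  exact hr.trans hl

lemma conjTranspose_evolve (hH : H.IsHermitian) (t : ℝ) (W : Op Λ) :
    (evolve H t W)ᴴ = evolve H t Wᴴ := by
  have hexp (z : ℂ) : (exp (z • H))ᴴ = exp (star z • H) := by
    rw [← Matrix.exp_conjTranspose, Matrix.conjTranspose_smul, hH.eq]
  simp only [evolve, Matrix.conjTranspose_mul, hexp, mul_assoc]
  simp

end Evolution

section Truncation

variable {Λ : Type*} [Fintype Λ] [DecidableEq Λ]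

/-- The labels of the Pauli products that act off `Y` only. -/
def labelsOff (Y : Finset Λ) : Finset (Λ → Fin 4) :=
  Fintype.piFinset fun i => if i ∈ Y then {0} else univ

lemma card_labelsOff_pos (Y : Finset Λ) : 0 < #(labelsOff Y) := by
  refine card_pos.2 ⟨0, Fintype.mem_piFinset.2 fun i => ?_⟩
  split_ifs <;> simp

lemma pauliSupp_subset_compl_of_mem_labelsOff {Y : Finset Λ} {q : Λ → Fin 4}
    (hq : q ∈ labelsOff Y) : pauliSupp q ⊆ Yᶜ := by
  intro i hi
  rw [mem_compl]
  intro hY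
  have hqi := Fintype.mem_piFinset.1 hq i
  rw [if_pos hY, mem_singleton] at hqi
  exact mem_pauliSupp.1 hi hqi

lemma SupportedOn.commute_pauliProd {Y : Finset Λ} {A : Op Λ} (hA : SupportedOn Y A)
    {q : Λ → Fin 4} (hq : q ∈ labelsOff Y) : Commute (pauliProd q) A :=
  (hA.commute (supportedOn_pauliProd (pauliSupp_subset_compl_of_mem_labelsOff hq))
    disjoint_compl_right).symm

lemma sum_pauli_conj_ite (Y : Finset Λ) (p : Λ → Fin 4) (i : Λ) :
    ∑ a ∈ (if i ∈ Y then {0} else univ), pauli a * pauli (p i) * pauli a =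
      (#(if i ∈ Y then ({0} : Finset (Fin 4)) else univ) : ℂ) •
        if i ∈ pauliSupp p → i ∈ Y then pauli (p i) else 0 := by
  by_cases hi : i ∈ Y
  · simp [hi, pauli_zero]
  · simp only [if_neg hi, sum_pauli_conj]
    by_cases hp : p i = 0 <;> simp [hp, hi, mem_pauliSupp, pauli_zero]

lemma tensor_ite_pauli (Y : Finset Λ) (p : Λ → Fin 4) :
    tensor (fun i => if i ∈ pauliSupp p → i ∈ Y then pauli (p i) else 0) =
      if pauliSupp p ⊆ Y then pauliProd p else 0 := by
  split_ifs with h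
  · rw [pauliProd_eq_tensor]
    congr 1
    funext i
    exact if_pos (@h i)
  · obtain ⟨i, hi, hiY⟩ := not_subset.1 h
    ext σ τ
    exact prod_eq_zero (mem_univ i) (by simp [hi, hiY])

lemma sum_labelsOff_conj_pauliProd (Y : Finset Λ) (p : Λ → Fin 4) :
    ∑ q ∈ labelsOff Y, pauliProd q * pauliProd p * pauliProd q =
      (#(labelsOff Y) : ℂ) • if pauliSupp p ⊆ Y then pauliProd p else 0 := by
  simp only [pauliProd_eq_tensor, tensor_mul_tensor, labelsOff]
  rw [sum_piFinset_tensor (fun i => if i ∈ Y then {0} else univ)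
    (fun i a => pauli a * pauli (p i) * pauli a)]
  simp only [sum_pauli_conj_ite, tensor_smul, tensor_ite_pauli, Fintype.card_piFinset,
    Nat.cast_prod, pauliProd_eq_tensor]

/-- The projection onto the operators supported on `Y`: it keeps the Pauli products that act on `Y`
only. -/
def trunc (Y : Finset Λ) : Op Λ →ₗ[ℂ] Op Λ where
  toFun A := ∑ p with pauliSupp p ⊆ Y, pauliCoeff p A • pauliProd p
  map_add' A B := by simp [pauliCoeff_add, add_smul, sum_add_distrib]
  map_smul' z A := by simp [pauliCoeff_smul, mul_smul, smul_sum]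

lemma trunc_apply (Y : Finset Λ) (A : Op Λ) :
    trunc Y A = ∑ p with pauliSupp p ⊆ Y, pauliCoeff p A • pauliProd p := rfl

lemma pauliCoeff_trunc (Y : Finset Λ) (A : Op Λ) (p : Λ → Fin 4) :
    pauliCoeff p (trunc Y A) = if pauliSupp p ⊆ Y then pauliCoeff p A else 0 := by
  rw [trunc_apply, pauliCoeff_sum_smul_pauliProd p _ fun q => pauliCoeff q A]
  simp

lemma norm_pauliCoeff_trunc_le (Y : Finset Λ) (A : Op Λ) (p : Λ → Fin 4) :
    ‖pauliCoeff p (trunc Y A)‖ ≤ ‖pauliCoeff p A‖ := by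
  rw [pauliCoeff_trunc]
  split_ifs <;> simp

lemma norm_pauliCoeff_sub_trunc_le (Y : Finset Λ) (A : Op Λ) (p : Λ → Fin 4) :
    ‖pauliCoeff p (A - trunc Y A)‖ ≤ ‖pauliCoeff p A‖ := by
  rw [pauliCoeff_sub, pauliCoeff_trunc]
  split_ifs <;> simp

lemma supportedOn_trunc (Y : Finset Λ) (A : Op Λ) : SupportedOn Y (trunc Y A) :=
  supportedOn_iff_pauliCoeff_eq_zero.2 fun p hp => by rw [pauliCoeff_trunc, if_neg hp]

lemma trunc_eq_self {Y : Finset Λ} {A : Op Λ} (h : SupportedOn Y A) : trunc Y A = A := by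
  refine ext_pauliCoeff fun p => ?_
  rw [pauliCoeff_trunc]
  split_ifs with hp
  · rfl
  · exact (h.pauliCoeff_eq_zero hp).symm

lemma isHermitian_trunc {A : Op Λ} (hA : A.IsHermitian) (Y : Finset Λ) :
    (trunc Y A).IsHermitian := by
  refine ext_pauliCoeff fun p => ?_
  rw [pauliCoeff_conjTranspose, pauliCoeff_trunc]
  split_ifs
  · rw [← pauliCoeff_conjTranspose, hA.eq]
  · exact star_zero ℂ

lemma card_smul_trunc (Y : Finset Λ) (A : Op Λ) :
    (#(labelsOff Y) : ℂ) • trunc Y A = ∑ q ∈ labelsOff Y, pauliProd q * A * pauliProd q := by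
  conv_rhs => rw [← sum_pauliCoeff_smul_pauliProd A]
  simp only [mul_sum, sum_mul]
  rw [sum_comm]
  simp only [Matrix.mul_smul, Matrix.smul_mul, ← smul_sum, sum_labelsOff_conj_pauliProd]
  rw [trunc_apply, sum_filter, smul_sum]
  refine sum_congr rfl fun p _ => ?_
  split_ifs
  · exact smul_comm _ _ _
  · simp only [smul_zero]

lemma trunc_eq_iff_card_smul {Y : Finset Λ} {A B : Op Λ} : trunc Y A = B ↔
    ∑ q ∈ labelsOff Y, pauliProd q * A * pauliProd q = (#(labelsOff Y) : ℂ) • B := by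
  rw [← card_smul_trunc]
  exact (smul_right_injective (Op Λ) (Nat.cast_ne_zero.2 (card_labelsOff_pos Y).ne')).eq_iff.symm

lemma opNorm_trunc_le (Y : Finset Λ) (A : Op Λ) : opNorm (trunc Y A) ≤ opNorm A := by
  have hcard : (0 : ℝ) < #(labelsOff Y) := Nat.cast_pos.2 (card_labelsOff_pos Y)
  refine le_of_mul_le_mul_left ?_ hcard
  calc #(labelsOff Y) * opNorm (trunc Y A)
      = opNorm ((#(labelsOff Y) : ℂ) • trunc Y A) := by
        rw [opNorm, opNorm, map_smul, norm_smul, Complex.norm_natCast]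
    _ ≤ ∑ q ∈ labelsOff Y, opNorm (pauliProd q * A * pauliProd q) := by
        rw [card_smul_trunc, opNorm, map_sum]
        exact norm_sum_le _ _
    _ = #(labelsOff Y) * opNorm A := by
        simp only [opNorm_mul_mem_unitary (pauliProd_mem_unitary _),
          opNorm_mem_unitary_mul (pauliProd_mem_unitary _), sum_const, nsmul_eq_mul]

lemma trunc_mul_left {Y : Finset Λ} {B : Op Λ} (hB : SupportedOn Y B) (A : Op Λ) :
    trunc Y (B * A) = B * trunc Y A := by
  rw [trunc_eq_iff_card_smul, ← Matrix.mul_smul, card_smul_trunc, mul_sum]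
  refine sum_congr rfl fun q hq => ?_
  rw [← mul_assoc, (hB.commute_pauliProd hq).eq, mul_assoc, mul_assoc, mul_assoc]

lemma trunc_mul_right {Y : Finset Λ} {B : Op Λ} (hB : SupportedOn Y B) (A : Op Λ) :
    trunc Y (A * B) = trunc Y A * B := by
  rw [trunc_eq_iff_card_smul, ← Matrix.smul_mul, card_smul_trunc, sum_mul]
  refine sum_congr rfl fun q hq => ?_
  rw [← mul_assoc, mul_assoc _ B, ← (hB.commute_pauliProd hq).eq]
  simp only [mul_assoc]

lemma trunc_lie_left {Y : Finset Λ} {B : Op Λ} (hB : SupportedOn Y B) (A : Op Λ) :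
    trunc Y ⁅B, A⁆ = ⁅B, trunc Y A⁆ := by
  rw [Ring.lie_def, map_sub, trunc_mul_left hB, trunc_mul_right hB, Ring.lie_def]

lemma frobNorm_sub_trunc_sq (Y : Finset Λ) (A : Op Λ) :
    frobNorm (A - trunc Y A) ^ 2 = ∑ p with ¬ pauliSupp p ⊆ Y, ‖pauliCoeff p A‖ ^ 2 := by
  rw [frobNorm_sq, sum_filter]
  refine sum_congr rfl fun p _ => ?_
  rw [pauliCoeff_sub, pauliCoeff_trunc]
  by_cases h : pauliSupp p ⊆ Y <;> simp [h]

lemma frobNorm_sub_trunc_le (Y : Finset Λ) (A : Op Λ) : frobNorm (A - trunc Y A) ≤ frobNorm A := by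
  rw [← sq_le_sq₀ (frobNorm_nonneg _) (frobNorm_nonneg _), frobNorm_sub_trunc_sq, frobNorm_sq]
  exact sum_le_sum_of_subset_of_nonneg (filter_subset _ _) fun _ _ _ => sq_nonneg _

lemma supportedOn_iff_commute {Y : Finset Λ} {A : Op Λ} :
    SupportedOn Y A ↔ ∀ q ∈ labelsOff Y, Commute (pauliProd q) A := by
  refine ⟨fun h _ => h.commute_pauliProd, fun h => ?_⟩
  have htrunc : trunc Y A = A := by
    rw [trunc_eq_iff_card_smul, Nat.cast_smul_eq_nsmul, ← sum_const]
    refine sum_congr rfl fun q hq => ?_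
    rw [(h q hq).eq, mul_assoc, pauliProd_mul_self, mul_one]
  exact htrunc ▸ supportedOn_trunc Y A

open scoped Matrix.Norms.L2Operator in
lemma SupportedOn.exp_smul {Y : Finset Λ} {A : Op Λ} (h : SupportedOn Y A) (z : ℂ) :
    SupportedOn Y (NormedSpace.exp (z • A)) := by
  rw [supportedOn_iff_commute] at *
  exact fun q hq => ((h q hq).smul_right z).exp_right

lemma trunc_evolve {Y : Finset Λ} {H : Op Λ} (hH : SupportedOn Y H) (t : ℝ) (A : Op Λ) :
    trunc Y (evolve H t A) = evolve H t (trunc Y A) := by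
  rw [evolve, evolve, trunc_mul_right (hH.exp_smul _), trunc_mul_left (hH.exp_smul _)]

open scoped Matrix.Norms.L2Operator in
lemma evolve_eq_self {Y : Finset Λ} {H W : Op Λ} (hH : SupportedOn Yᶜ H) (hW : SupportedOn Y W)
    (t : ℝ) : evolve H t W = W := by
  rw [evolve, ((hH.exp_smul _).commute hW disjoint_compl_left).eq, mul_assoc,
    exp_smul_mul_exp_neg_smul, mul_one]

end Truncation

section PairNorm

variable {Λ : Type*} {p q : Λ → Fin 4} {i : Λ}

/-- `1` if the Pauli product `q` acts at `i`, and `0` otherwise. -/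
def act (q : Λ → Fin 4) (i : Λ) : ℝ := if q i = 0 then 0 else 1

lemma act_of_eq_zero (h : q i = 0) : act q i = 0 := if_pos h

lemma act_of_ne_zero (h : q i ≠ 0) : act q i = 1 := if_neg h

lemma act_nonneg (q : Λ → Fin 4) (i : Λ) : 0 ≤ act q i := by
  unfold act
  split_ifs <;> norm_num

lemma act_le_one (q : Λ → Fin 4) (i : Λ) : act q i ≤ 1 := by
  unfold act
  split_ifs <;> norm_num

lemma act_mul_self (q : Λ → Fin 4) (i : Λ) : act q i * act q i = act q i := by
  unfold act
  split_ifs <;> norm_num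

lemma pauliProdMul_comm (p q : Λ → Fin 4) : pauliProdMul p q = pauliProdMul q p := by
  have h (a b : Fin 4) : pauliMul a b = pauliMul b a := by revert a b; decide
  exact funext fun i => h _ _

lemma pauliProdMul_of_left_eq_zero (h : p i = 0) : pauliProdMul p q i = q i := by
  rw [pauliProdMul, h, pauliMul_zero_left]

lemma act_pauliProdMul_of_left_eq_zero (h : p i = 0) : act (pauliProdMul p q) i = act q i := by
  rw [act, pauliProdMul_of_left_eq_zero h, act]

lemma act_pauliProdMul_le (p q : Λ → Fin 4) (i : Λ) :
    act (pauliProdMul p q) i ≤ act p i + act q i := by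
  by_cases hp : p i = 0
  · rw [act_pauliProdMul_of_left_eq_zero hp]
    linarith [act_nonneg p i]
  · linarith [act_of_ne_zero hp, act_le_one (pauliProdMul p q) i, act_nonneg q i]

variable [Fintype Λ]

lemma sum_act (q : Λ → Fin 4) : ∑ i, act q i = #(pauliSupp q) := by
  simp only [act, pauliSupp, card_filter, ite_not, Nat.cast_sum, Nat.cast_ite, Nat.cast_zero,
    Nat.cast_one]

lemma card_pauliSupp_pauliProdMul_le (p q : Λ → Fin 4) :
    #(pauliSupp (pauliProdMul p q)) ≤ #(pauliSupp p) + #(pauliSupp q) := by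
  classical
  refine (card_le_card fun i hi => ?_).trans (card_union_le _ _)
  rw [mem_union, mem_pauliSupp, mem_pauliSupp]
  by_contra! h
  exact mem_pauliSupp.1 hi (by rw [pauliProdMul_of_left_eq_zero h.1, h.2])

variable [DecidableEq Λ]

lemma SupportedOn.norm_pauliCoeff_mul_act {X : Finset Λ} {A : Op Λ} (hA : SupportedOn X A)
    (hi : i ∉ X) (p : Λ → Fin 4) : ‖pauliCoeff p A‖ * act p i = 0 := by
  by_cases hp : p i = 0
  · rw [act_of_eq_zero hp, mul_zero]
  · rw [hA.pauliCoeff_eq_zero fun h => hi (h (mem_pauliSupp.2 hp)), norm_zero, zero_mul]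

/-- The total weight of the Pauli products in `A` that act both at `i` and at `j`. -/
def pairNorm (i j : Λ) (A : Op Λ) : ℝ := ∑ q, ‖pauliCoeff q A‖ * (act q i * act q j)

lemma pairNorm_self (i : Λ) (A : Op Λ) : pairNorm i i A = ∑ q, ‖pauliCoeff q A‖ * act q i := by
  simp only [pairNorm, act_mul_self]

lemma pairNorm_nonneg (i j : Λ) (A : Op Λ) : 0 ≤ pairNorm i j A :=
  sum_nonneg fun q _ => mul_nonneg (norm_nonneg _) (mul_nonneg (act_nonneg q i) (act_nonneg q j))

lemma pairNorm_mono {A B : Op Λ} (hAB : ∀ p, ‖pauliCoeff p A‖ ≤ ‖pauliCoeff p B‖) (i j : Λ) :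
    pairNorm i j A ≤ pairNorm i j B :=
  sum_le_sum fun p _ =>
    mul_le_mul_of_nonneg_right (hAB p) (mul_nonneg (act_nonneg p i) (act_nonneg p j))

lemma pairNorm_sum_le {ι : Type*} (i j : Λ) (s : Finset ι) (A : ι → Op Λ) :
    pairNorm i j (∑ a ∈ s, A a) ≤ ∑ a ∈ s, pairNorm i j (A a) := by
  simp only [pairNorm]
  rw [sum_comm]
  refine sum_le_sum fun q _ => ?_
  rw [← sum_mul, pauliCoeff_sum]
  exact mul_le_mul_of_nonneg_right (norm_sum_le _ _) (mul_nonneg (act_nonneg q i) (act_nonneg q j))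

lemma pairNorm_smul (i j : Λ) (z : ℂ) (A : Op Λ) :
    pairNorm i j (z • A) = ‖z‖ * pairNorm i j A := by
  simp only [pairNorm, pauliCoeff_smul, norm_mul, mul_sum, mul_assoc]

lemma pairNorm_pauliProd (i j : Λ) (r : Λ → Fin 4) :
    pairNorm i j (pauliProd r) = act r i * act r j := by
  simp [pairNorm, pauliCoeff_pauliProd, apply_ite, ite_mul]

open scoped Matrix.Norms.L2Operator in
lemma continuous_pairNorm (i j : Λ) : Continuous (pairNorm i j) :=
  continuous_finsetSum _ fun q _ =>
    (pauliCoeffₗ q).continuous_of_finiteDimensional.norm.mul continuous_const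

end PairNorm

section Commutator

variable {Λ : Type*} [Fintype Λ] [DecidableEq Λ]

lemma exists_lie_pauliProd_eq_smul (p q : Λ → Fin 4) : ∃ z : ℂ, ‖z‖ ≤ 2 ∧
    ⁅pauliProd p, pauliProd q⁆ = z • pauliProd (pauliProdMul p q) := by
  refine ⟨∏ i, pauliPhase (p i) (q i) - ∏ i, pauliPhase (q i) (p i), ?_, ?_⟩
  · refine (norm_sub_le _ _).trans_eq ?_
    rw [norm_prod_pauliPhase, norm_prod_pauliPhase]
    norm_num
  · rw [Ring.lie_def, pauliProd_mul, pauliProd_mul, pauliProdMul_comm q p, sub_smul]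

lemma lie_eq_sum_smul_lie_pauliProd (B A : Op Λ) : ⁅B, A⁆ =
    ∑ p, ∑ q, (pauliCoeff p B * pauliCoeff q A) • ⁅pauliProd p, pauliProd q⁆ := by
  conv_lhs => rw [← sum_pauliCoeff_smul_pauliProd B, ← sum_pauliCoeff_smul_pauliProd A]
  simp only [sum_lie, lie_sum, smul_lie, lie_smul, smul_sum, smul_smul]
  rw [sum_comm]
  simp only [mul_comm]

lemma pairNorm_lie_pauliProd_le {p : Λ → Fin 4} {i : Λ} (hp : p i = 0) (q : Λ → Fin 4) (j : Λ) :
    pairNorm i j ⁅pauliProd p, pauliProd q⁆ ≤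
      2 * ∑ l, act p l * act q l * (act q i * (act q j + act p j)) := by
  have hnonneg : ∀ l ∈ univ, 0 ≤ act p l * act q l * (act q i * (act q j + act p j)) :=
    fun l _ => mul_nonneg (mul_nonneg (act_nonneg _ _) (act_nonneg _ _))
      (mul_nonneg (act_nonneg _ _) (add_nonneg (act_nonneg _ _) (act_nonneg _ _)))
  by_cases h : ∀ l, p l = 0 ∨ q l = 0
  · rw [Ring.lie_def, (commute_pauliProd h).eq, sub_self]
    simpa [pairNorm, pauliCoeff_zero] using sum_nonneg hnonneg
  push Not at h
  obtain ⟨l, hpl, hql⟩ := h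
  obtain ⟨z, hz, hlie⟩ := exists_lie_pauliProd_eq_smul p q
  rw [hlie, pairNorm_smul, pairNorm_pauliProd, act_pauliProdMul_of_left_eq_zero hp]
  refine mul_le_mul hz ?_ (mul_nonneg (act_nonneg _ _) (act_nonneg _ _)) zero_le_two
  calc act q i * act (pauliProdMul p q) j
      ≤ act p l * act q l * (act q i * (act q j + act p j)) := by
        rw [act_of_ne_zero hpl, act_of_ne_zero hql, one_mul, one_mul, add_comm]
        exact mul_le_mul_of_nonneg_left (act_pauliProdMul_le p q j) (act_nonneg _ _)
    _ ≤ ∑ l, act p l * act q l * (act q i * (act q j + act p j)) :=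
        single_le_sum hnonneg (mem_univ l)

/-- `A` is a combination of Pauli products that act on at most `d` sites. -/
def DegreeLE (d : ℕ) (A : Op Λ) : Prop := ∀ q, d < #(pauliSupp q) → pauliCoeff q A = 0

lemma DegreeLE.mono {d : ℕ} {A B : Op Λ} (hB : DegreeLE d B)
    (hAB : ∀ p, ‖pauliCoeff p A‖ ≤ ‖pauliCoeff p B‖) : DegreeLE d A := fun q hq => by
  simpa [hB q hq] using hAB q

lemma DegreeLE.lie {k d : ℕ} {B A : Op Λ} (hB : DegreeLE k B) (hA : DegreeLE d A) :
    DegreeLE (k + d) ⁅B, A⁆ := by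
  intro r hr
  simp only [lie_eq_sum_smul_lie_pauliProd B A, pauliCoeff_sum]
  refine sum_eq_zero fun p _ => sum_eq_zero fun q _ => ?_
  rw [pauliCoeff_smul]
  by_cases hp : k < #(pauliSupp p)
  · rw [hB p hp, zero_mul, zero_mul]
  by_cases hq : d < #(pauliSupp q)
  · rw [hA q hq, mul_zero, zero_mul]
  obtain ⟨z, -, hz⟩ := exists_lie_pauliProd_eq_smul p q
  rw [hz, pauliCoeff_smul, pauliCoeff_pauliProd, if_neg, mul_zero, mul_zero]
  rintro rfl
  have := card_pauliSupp_pauliProdMul_le p q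
  omega

end Commutator

section Growth

variable {Λ : Type*} [Fintype Λ] [DecidableEq Λ] {B A V : Op Λ} {i : Λ} {k d : ℕ} {g : ℝ}
  {φ : Λ → Λ → ℝ}

lemma pairNorm_lie_le_sum (hB : ∀ p, p i ≠ 0 → pauliCoeff p B = 0) (A : Op Λ) (j : Λ) :
    pairNorm i j ⁅B, A⁆ ≤ ∑ p, ∑ q, ‖pauliCoeff p B‖ * ‖pauliCoeff q A‖ *
      (2 * ∑ l, act p l * act q l * (act q i * (act q j + act p j))) := by
  rw [lie_eq_sum_smul_lie_pauliProd]
  refine (pairNorm_sum_le _ _ _ _).trans (sum_le_sum fun p _ => ?_)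
  refine (pairNorm_sum_le _ _ _ _).trans (sum_le_sum fun q _ => ?_)
  rw [pairNorm_smul, norm_mul]
  by_cases hp : p i = 0
  · exact mul_le_mul_of_nonneg_left (pairNorm_lie_pauliProd_le hp q j) (by positivity)
  · simp [hB p hp]

lemma sum_mul_sum_act_eq (B A : Op Λ) (i j : Λ) :
    ∑ p, ∑ q, ‖pauliCoeff p B‖ * ‖pauliCoeff q A‖ *
      (2 * ∑ l, act p l * act q l * (act q i * (act q j + act p j))) =
      2 * (∑ q, ‖pauliCoeff q A‖ * (act q i * act q j) * ∑ l, act q l * pairNorm l l B +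
        ∑ l, pairNorm i l A * pairNorm l j B) := by
  have diagonal : ∑ q, ‖pauliCoeff q A‖ * (act q i * act q j) * ∑ l, act q l * pairNorm l l B =
      ∑ p, ∑ q, ∑ l, ‖pauliCoeff q A‖ * (act q i * act q j) *
        (act q l * (‖pauliCoeff p B‖ * act p l)) := by
    simp only [pairNorm_self, mul_sum]
    rw [sum_congr rfl fun q _ => sum_comm, sum_comm]
  have convolution : ∑ l, pairNorm i l A * pairNorm l j B = ∑ p, ∑ q, ∑ l,
      ‖pauliCoeff q A‖ * (act q i * act q l) * (‖pauliCoeff p B‖ * (act p l * act p j)) := by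
    simp only [pairNorm, sum_mul_sum]
    rw [sum_congr rfl fun l _ => sum_comm, sum_comm, sum_congr rfl fun p _ => sum_comm]
  rw [diagonal, convolution]
  simp only [← sum_add_distrib, mul_sum]
  exact sum_congr rfl fun p _ => sum_congr rfl fun q _ => sum_congr rfl fun l _ => by ring

lemma DegreeLE.sum_act_le (hA : DegreeLE d A) (hg : ∀ l, pairNorm l l B ≤ g) (i j : Λ) :
    ∑ q, ‖pauliCoeff q A‖ * (act q i * act q j) * ∑ l, act q l * pairNorm l l B ≤
      d * g * pairNorm i j A := by
  rw [pairNorm, mul_sum]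
  refine sum_le_sum fun q _ => ?_
  by_cases hq : d < #(pauliSupp q)
  · simp [hA q hq]
  rw [mul_comm (d * g)]
  refine mul_le_mul_of_nonneg_left ?_
    (mul_nonneg (norm_nonneg _) (mul_nonneg (act_nonneg q i) (act_nonneg q j)))
  have hg0 : 0 ≤ g := (pairNorm_nonneg i i B).trans (hg i)
  calc ∑ l, act q l * pairNorm l l B
      ≤ ∑ l, act q l * g :=
        sum_le_sum fun l _ => mul_le_mul_of_nonneg_left (hg l) (act_nonneg q l)
    _ = #(pauliSupp q) * g := by rw [← sum_mul, sum_act]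
    _ ≤ d * g := by
        gcongr
        exact not_lt.1 hq

/-- A Pauli product of `B` does not act at `i`. If it fails to commute with a product of `A`, then
they share a site `l`, and the commutator acts at `i` through `A` and at `j` through `A` or `B`. -/
lemma pairNorm_lie_le (hB : ∀ p, p i ≠ 0 → pauliCoeff p B = 0) (hA : DegreeLE d A)
    (hg : ∀ l, pairNorm l l B ≤ g) (j : Λ) :
    pairNorm i j ⁅B, A⁆ ≤ 2 * (d * g * pairNorm i j A + ∑ l, pairNorm i l A * pairNorm l j B) := by
  refine (pairNorm_lie_le_sum hB A j).trans ?_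
  rw [sum_mul_sum_act_eq]
  gcongr
  exact hA.sum_act_le hg i j

/-- `A` consists of Pauli products on at most `k` sites, with total weight at most `g` at each site
and at most `φ i j` at each pair of sites. -/
structure PauliDecay (k : ℕ) (g : ℝ) (φ : Λ → Λ → ℝ) (A : Op Λ) : Prop where
  degreeLE : DegreeLE k A
  pairNorm_self_le : ∀ i, pairNorm i i A ≤ g
  pairNorm_le : ∀ i j, pairNorm i j A ≤ φ i j

lemma PauliDecay.mono (hB : PauliDecay k g φ B)
    (hAB : ∀ p, ‖pauliCoeff p A‖ ≤ ‖pauliCoeff p B‖) : PauliDecay k g φ A where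
  degreeLE := hB.degreeLE.mono hAB
  pairNorm_self_le i := (pairNorm_mono hAB i i).trans (hB.pairNorm_self_le i)
  pairNorm_le i j := (pairNorm_mono hAB i j).trans (hB.pairNorm_le i j)

lemma PauliDecay.nonneg (hB : PauliDecay k g φ B) (i j : Λ) : 0 ≤ φ i j :=
  (pairNorm_nonneg i j B).trans (hB.pairNorm_le i j)

lemma DegreeLE.iterate_lie (hB : DegreeLE k B) (hV : DegreeLE k V) (n : ℕ) :
    DegreeLE ((n + 1) * k) ((fun A => ⁅B, A⁆)^[n] V) := by
  induction n with
  | zero => simpa using hV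
  | succ n ih =>
    rw [Function.iterate_succ_apply', show (n + 1 + 1) * k = k + (n + 1) * k by ring]
    exact hB.lie ih

variable {G : ℝ}

lemma pairNorm_iterate_lie_le (hB : PauliDecay k g φ B) (hBi : ∀ p, p i ≠ 0 → pauliCoeff p B = 0)
    (hV : PauliDecay k g φ V) (hgG : g * k ≤ G) (hconv : ∀ j, ∑ l, φ i l * φ l j ≤ G * φ i j)
    (n : ℕ) (j : Λ) :
    pairNorm i j ((fun A => ⁅B, A⁆)^[n] V) ≤ (2 * G) ^ n * (n + 1).factorial * φ i j := by
  have hg0 : 0 ≤ g := (pairNorm_nonneg i i B).trans (hB.pairNorm_self_le i)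
  have hG0 : 0 ≤ G := (mul_nonneg hg0 k.cast_nonneg).trans hgG
  induction n generalizing j with
  | zero => simpa using hV.pairNorm_le i j
  | succ n ih =>
    set A := (fun A => ⁅B, A⁆)^[n] V
    set κ : ℝ := (2 * G) ^ n * (n + 1).factorial with hκ
    have local_part : (((n + 1) * k : ℕ) : ℝ) * g * pairNorm i j A ≤ (n + 1) * G * (κ * φ i j) := by
      refine mul_le_mul ?_ (ih j) (pairNorm_nonneg _ _ _) (by positivity)
      push_cast
      rw [mul_assoc, mul_comm (k : ℝ)]
      gcongr
    have convolution : ∑ l, pairNorm i l A * pairNorm l j B ≤ G * (κ * φ i j) := by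
      calc ∑ l, pairNorm i l A * pairNorm l j B
          ≤ ∑ l, κ * φ i l * φ l j := sum_le_sum fun l _ =>
            mul_le_mul (ih l) (hB.pairNorm_le l j) (pairNorm_nonneg _ _ _)
              (mul_nonneg (by positivity) (hB.nonneg i l))
        _ = κ * ∑ l, φ i l * φ l j := by simp only [mul_sum, mul_assoc]
        _ ≤ κ * (G * φ i j) := by
            gcongr
            exact hconv j
        _ = G * (κ * φ i j) := by ring
    rw [Function.iterate_succ_apply']
    calc pairNorm i j ⁅B, A⁆
        ≤ 2 * ((n + 1) * G * (κ * φ i j) + G * (κ * φ i j)) :=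
          (pairNorm_lie_le hBi (hB.degreeLE.iterate_lie hV.degreeLE n) hB.pairNorm_self_le
            j).trans (by gcongr)
      _ = (2 * G) ^ (n + 1) * (n + 1 + 1).factorial * φ i j := by
          rw [hκ, Nat.factorial_succ (n + 1)]
          push_cast
          ring

lemma pairNorm_evolve_le (hB : PauliDecay k g φ B) (hBi : ∀ p, p i ≠ 0 → pauliCoeff p B = 0)
    (hV : PauliDecay k g φ V) (hgG : g * k ≤ G) (hconv : ∀ j, ∑ l, φ i l * φ l j ≤ G * φ i j)
    {s : ℝ} (hs : 0 ≤ s) (hGs : 2 * G * s < 1) (j : Λ) :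
    pairNorm i j (evolve B s V) ≤ φ i j / (1 - 2 * G * s) ^ 2 := by
  have hg0 : 0 ≤ g := (pairNorm_nonneg i i B).trans (hB.pairNorm_self_le i)
  have hG0 : 0 ≤ G := (mul_nonneg hg0 k.cast_nonneg).trans hgG
  have hx : 0 ≤ 2 * G * s := by positivity
  have hgeo : HasSum (fun n : ℕ => ((n + 1).choose 1 : ℝ) * (2 * G * s) ^ n)
      (1 / (1 - 2 * G * s) ^ 2) :=
    hasSum_choose_mul_geometric_of_norm_lt_one 1 (by rwa [Real.norm_of_nonneg hx])
  have hterm (n : ℕ) : pairNorm i j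
      (((n.factorial : ℂ)⁻¹ * (Complex.I * s) ^ n) • (fun A => ⁅B, A⁆)^[n] V) ≤
        φ i j * (((n + 1).choose 1 : ℝ) * (2 * G * s) ^ n) := by
    have hnorm : ‖(n.factorial : ℂ)⁻¹ * (Complex.I * s) ^ n‖ = (n.factorial : ℝ)⁻¹ * s ^ n := by
      simp [abs_of_nonneg hs]
    rw [pairNorm_smul, hnorm]
    refine (mul_le_mul_of_nonneg_left (pairNorm_iterate_lie_le hB hBi hV hgG hconv n j)
      (by positivity)).trans_eq ?_
    rw [Nat.factorial_succ, Nat.choose_one_right]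
    push_cast
    field_simp
    ring
  have hlim := ((continuous_pairNorm i j).tendsto _).comp (hasSum_evolve B V s).tendsto_sum_nat
  refine le_of_tendsto' hlim fun N => ?_
  calc pairNorm i j (∑ n ∈ range N, ((n.factorial : ℂ)⁻¹ * (Complex.I * s) ^ n) •
        (fun A => ⁅B, A⁆)^[n] V)
      ≤ ∑ n ∈ range N, φ i j * (((n + 1).choose 1 : ℝ) * (2 * G * s) ^ n) :=
        (pairNorm_sum_le i j _ _).trans (sum_le_sum fun n _ => hterm n)
    _ ≤ φ i j * (1 / (1 - 2 * G * s) ^ 2) := by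
        rw [← mul_sum]
        exact mul_le_mul_of_nonneg_left (sum_le_hasSum _ (fun n _ => by positivity) hgeo)
          (hB.nonneg i j)
    _ = φ i j / (1 - 2 * G * s) ^ 2 := mul_one_div _ _

end Growth

section EnergyEstimate

/-- The square root `√(‖x‖² + δ²)` is differentiable also where `x` vanishes. -/
lemma norm_le_of_inner_deriv_le {E : Type*} [NormedAddCommGroup E] [InnerProductSpace ℝ E]
    {x x' : ℝ → E} {K a b : ℝ} (hab : a ≤ b) (hK : 0 ≤ K)
    (hx : ∀ u ∈ Set.Icc a b, HasDerivAt x (x' u) u)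
    (hinner : ∀ u ∈ Set.Icc a b, inner ℝ (x u) (x' u) ≤ K * ‖x u‖) :
    ‖x b‖ ≤ ‖x a‖ + K * (b - a) := by
  refine le_of_forall_pos_le_add fun δ hδ => ?_
  let y (u : ℝ) : ℝ := √(‖x u‖ ^ 2 + δ ^ 2)
  have hpos (u : ℝ) : 0 < ‖x u‖ ^ 2 + δ ^ 2 := by positivity
  have hy : ∀ u ∈ Set.Icc a b, HasDerivAt y (2 * inner ℝ (x u) (x' u) / (2 * y u)) u :=
    fun u hu => ((hx u hu).norm_sq.add_const _).sqrt (hpos u).ne'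
  have norm_le_y (u : ℝ) : ‖x u‖ ≤ y u := Real.le_sqrt_of_sq_le (by nlinarith)
  have y_le : y a ≤ ‖x a‖ + δ := by
    refine Real.sqrt_le_iff.2 ⟨by positivity, ?_⟩
    nlinarith [mul_nonneg (norm_nonneg (x a)) hδ.le]
  have hderiv : ∀ u ∈ interior (Set.Icc a b), deriv y u ≤ K := fun u hu => by
    rw [(hy u (interior_subset hu)).deriv, mul_div_mul_left _ _ two_ne_zero,
      div_le_iff₀ (Real.sqrt_pos.2 (hpos u))]
    exact (hinner u (interior_subset hu)).trans (mul_le_mul_of_nonneg_left (norm_le_y u) hK)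
  have hgrowth : y b - y a ≤ K * (b - a) :=
    (convex_Icc a b).image_sub_le_mul_sub_of_deriv_le
      (fun u hu => (hy u hu).continuousAt.continuousWithinAt)
      (fun u hu => (hy u (interior_subset hu)).differentiableAt.differentiableWithinAt) hderiv
      a (Set.left_mem_Icc.2 hab) b (Set.right_mem_Icc.2 hab) hab
  linarith [norm_le_y b]

end EnergyEstimate

section InteractionPicture

variable {Λ : Type*} [Fintype Λ] [DecidableEq Λ]

lemma isHermitian_evolve {H A : Op Λ} (hH : H.IsHermitian) (hA : A.IsHermitian) (t : ℝ) :
    (evolve H t A).IsHermitian := by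
  rw [Matrix.IsHermitian, conjTranspose_evolve hH, hA.eq]

lemma im_ntr_eq_zero {A : Op Λ} (hA : A.IsHermitian) : (ntr A).im = 0 := by
  rw [← Complex.conj_eq_iff_im]
  simp only [ntr, map_div₀, starRingEnd_apply, ← Matrix.trace_conjTranspose, hA.eq,
    Matrix.conjTranspose_one]

lemma re_inner_pauliVec_lie_eq_zero {V : Op Λ} (hV : V.IsHermitian) (A : Op Λ) :
    (inner ℂ (pauliVec A) (pauliVec (Complex.I • ⁅V, A⁆))).re = 0 := by
  have hcyclic : ntr (Aᴴ * ⁅V, A⁆) = ntr (Aᴴ * V * A) - ntr (A * V * Aᴴ) := by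
    simp only [ntr, ← sub_div]
    rw [Ring.lie_def, mul_sub, Matrix.trace_sub, ← mul_assoc, Matrix.trace_mul_comm Aᴴ (A * V)]
  rw [map_smul, inner_smul_right, inner_pauliVec, hcyclic]
  simp [im_ntr_eq_zero (Matrix.isHermitian_conjTranspose_mul_mul A hV),
    im_ntr_eq_zero (Matrix.isHermitian_mul_mul_conjTranspose A hV)]

/-- The commutator with `trunc Y V` rotates the part of `C` off `Y` and does not change its norm;
only the part of `V` off `Y` feeds it. -/
lemma re_inner_sub_trunc_lie_le {V : Op Λ} (hV : V.IsHermitian) (Y : Finset Λ) (C : Op Λ) :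
    (inner ℂ (pauliVec (C - trunc Y C))
      (pauliVec (Complex.I • ⁅V, C⁆ - trunc Y (Complex.I • ⁅V, C⁆)))).re ≤
      2 * frobNorm (V - trunc Y V) * opNorm C * ‖pauliVec (C - trunc Y C)‖ := by
  set M := ⁅V - trunc Y V, C⁆ with hM
  have hsplit : Complex.I • ⁅V, C⁆ - trunc Y (Complex.I • ⁅V, C⁆) =
      Complex.I • (M - trunc Y M) + Complex.I • ⁅trunc Y V, C - trunc Y C⁆ := by
    have hV' : ⁅V, C⁆ = M + ⁅trunc Y V, C⁆ := by rw [hM, sub_lie, sub_add_cancel]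
    rw [map_smul, ← smul_sub, ← smul_add, hV', map_add, trunc_lie_left (supportedOn_trunc Y V),
      lie_sub]
    abel_nf
  rw [hsplit, map_add, inner_add_right, Complex.add_re,
    re_inner_pauliVec_lie_eq_zero (isHermitian_trunc hV Y), add_zero]
  calc (inner ℂ (pauliVec (C - trunc Y C)) (pauliVec (Complex.I • (M - trunc Y M)))).re
      ≤ ‖pauliVec (C - trunc Y C)‖ * ‖pauliVec (Complex.I • (M - trunc Y M))‖ :=
        (Complex.re_le_norm _).trans (norm_inner_le_norm _ _)
    _ = frobNorm (M - trunc Y M) * ‖pauliVec (C - trunc Y C)‖ := by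
        rw [map_smul, norm_smul, Complex.norm_I, one_mul, mul_comm, ← frobNorm_eq_norm_pauliVec]
    _ ≤ 2 * frobNorm (V - trunc Y V) * opNorm C * ‖pauliVec (C - trunc Y C)‖ :=
        mul_le_mul_of_nonneg_right
          ((frobNorm_sub_trunc_le Y M).trans (frobNorm_lie_le _ _)) (norm_nonneg _)

open scoped Matrix.Norms.L2Operator in
lemma frobNorm_evolve_sub_trunc_le {H H₀ W : Op Λ} {X Y : Finset Λ} {K t : ℝ}
    (hH : H.IsHermitian) (hH₀ : H₀.IsHermitian) (hX : SupportedOn Xᶜ H₀) (hW : SupportedOn X W)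
    (hXY : X ⊆ Y) (hW1 : opNorm W ≤ 1) (ht : 0 ≤ t)
    (hK : ∀ s, 0 ≤ s → s ≤ t →
      frobNorm (evolve H₀ s (H - H₀) - trunc Y (evolve H₀ s (H - H₀))) ≤ K) :
    frobNorm (evolve H t W - trunc Y (evolve H t W)) ≤ 2 * K * t := by
  let P : Op Λ →L[ℂ] EuclideanSpace ℂ (Λ → Fin 4) :=
    (pauliVec ∘ₗ (LinearMap.id - trunc Y)).toContinuousLinearMap
  have hP (A : Op Λ) : P A = pauliVec (A - trunc Y A) := rfl
  let C (u : ℝ) : Op Λ := evolve H₀ (t - u) (evolve H u W)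
  let V (u : ℝ) : Op Λ := evolve H₀ (t - u) (H - H₀)
  have hC0 : P (C 0) = 0 := by
    simp only [C, evolve_zero, evolve_eq_self hX hW, hP, trunc_eq_self (hW.mono hXY), sub_self,
      map_zero]
  have hCt : C t = evolve H t W := by simp only [C, sub_self, evolve_zero]
  have hK0 : 0 ≤ K := (frobNorm_nonneg _).trans (hK 0 le_rfl ht)
  have hderiv : ∀ u ∈ Set.Icc 0 t,
      HasDerivAt (fun u => P (C u)) (P (Complex.I • ⁅V u, C u⁆)) u := fun u _ =>
    (P.restrictScalars ℝ).hasFDerivAt.comp_hasDerivAt u (hasDerivAt_interaction H H₀ W t u)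
  have hinner : ∀ u ∈ Set.Icc 0 t,
      (inner ℂ (P (C u)) (P (Complex.I • ⁅V u, C u⁆))).re ≤ 2 * K * ‖P (C u)‖ := fun u hu => by
    have hCu : opNorm (C u) ≤ 1 := by rwa [opNorm_evolve hH₀, opNorm_evolve hH]
    have hVu : frobNorm (V u - trunc Y (V u)) ≤ K :=
      hK (t - u) (sub_nonneg.2 hu.2) (sub_le_self t hu.1)
    refine (re_inner_sub_trunc_lie_le (isHermitian_evolve hH₀ (hH.sub hH₀) _) Y (C u)).trans ?_
    refine mul_le_mul_of_nonneg_right ?_ (norm_nonneg _)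
    refine (mul_le_of_le_one_right (mul_nonneg zero_le_two (frobNorm_nonneg _)) hCu).trans ?_
    exact mul_le_mul_of_nonneg_left hVu zero_le_two
  let _ : InnerProductSpace ℝ (EuclideanSpace ℂ (Λ → Fin 4)) := .complexToReal
  have hfinal := norm_le_of_inner_deriv_le ht (by positivity) hderiv hinner
  rwa [hC0, norm_zero, zero_add, sub_zero, hCt, hP, ← frobNorm_eq_norm_pauliVec] at hfinal

end InteractionPicture

section PauliWeights

variable {Λ : Type*} [Fintype Λ]

lemma one_le_pauliBase (h : Finset Λ → Op Λ) : 1 ≤ pauliBase h := by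
  unfold pauliBase
  split_ifs <;> norm_num

lemma pauliBase_le (h : Finset Λ → Op Λ) : pauliBase h ≤ 4 := by
  unfold pauliBase
  split_ifs <;> norm_num

variable [DecidableEq Λ]

lemma sum_norm_pauliCoeff_le {A : Op Λ} {s : Finset (Λ → Fin 4)}
    (hs : ∀ p, p ∉ s → pauliCoeff p A = 0) : ∑ p, ‖pauliCoeff p A‖ ≤ √(#s) * frobNorm A := by
  have hsum : ∑ p, ‖pauliCoeff p A‖ = ∑ p ∈ s, ‖pauliCoeff p A‖ :=
    (sum_subset (subset_univ s) fun p _ hp => by rw [hs p hp, norm_zero]).symm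
  rw [hsum, ← Real.sqrt_sq (frobNorm_nonneg A), ← Real.sqrt_mul (Nat.cast_nonneg _), frobNorm_sq]
  refine Real.le_sqrt_of_sq_le (sq_sum_le_card_mul_sum_sq.trans ?_)
  gcongr
  exact subset_univ s

lemma IsPauliSumOn.pauliCoeff_eq_zero {Z : Finset Λ} {A : Op Λ} (hA : IsPauliSumOn Z A)
    {p : Λ → Fin 4} (hp : ¬ ∀ i, p i ≠ 0 ↔ i ∈ Z) : pauliCoeff p A = 0 := by
  suffices h : Submodule.span ℂ {P : Op Λ | ∃ q : Λ → Fin 4, (∀ i, q i ≠ 0 ↔ i ∈ Z) ∧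
      P = pauliProd q} ≤ LinearMap.ker (pauliCoeffₗ p) from h hA
  rw [Submodule.span_le]
  rintro _ ⟨q, hq, rfl⟩
  change pauliCoeff p (pauliProd q) = 0
  rw [pauliCoeff_pauliProd, if_neg]
  rintro rfl
  exact hp hq

lemma card_piFinset_ite {κ : Type*} (Z : Finset Λ) (s : Finset κ) (a : κ) :
    #(Fintype.piFinset fun i => if i ∈ Z then s else {a}) = #s ^ #Z := by
  simp [Fintype.card_piFinset, apply_ite card]

lemma exists_card_eq_pauliBase_pow {h : Finset Λ → Op Λ} {Z : Finset Λ}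
    (hZ : SupportedOn Z (h Z)) : ∃ s : Finset (Λ → Fin 4),
      (∀ p, p ∉ s → pauliCoeff p (h Z) = 0) ∧ (#s : ℝ) = pauliBase h ^ #Z := by
  by_cases hS : ∀ Z, IsPauliSumOn Z (h Z)
  · refine ⟨Fintype.piFinset fun i => if i ∈ Z then univ.erase 0 else {0}, fun p hp => ?_, ?_⟩
    · refine (hS Z).pauliCoeff_eq_zero fun hpZ => hp (Fintype.mem_piFinset.2 fun i => ?_)
      split_ifs with hi
      · simpa using (hpZ i).2 hi
      · simpa using mt (hpZ i).1 hi
    · rw [card_piFinset_ite, pauliBase, if_pos hS]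
      norm_num
  · refine ⟨Fintype.piFinset fun i => if i ∈ Z then univ else {0}, fun p hp => ?_, ?_⟩
    · refine hZ.pauliCoeff_eq_zero fun hpZ => hp (Fintype.mem_piFinset.2 fun i => ?_)
      split_ifs with hi
      · exact mem_univ _
      · simpa using fun h0 => hi (hpZ (mem_pauliSupp.2 h0))
    · rw [card_piFinset_ite, pauliBase, if_neg hS]
      norm_num

/-- Every Pauli product in `A` acts at some site of `X`, so those off `Y` are counted by the pairs
`(i, j)` with `i ∈ X` and `j ∉ Y`. -/
lemma frobNorm_sub_trunc_sq_le {A : Op Λ} {X : Finset Λ} (hA : trunc Xᶜ A = 0) (Y : Finset Λ) :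
    frobNorm (A - trunc Y A) ^ 2 ≤ ∑ i ∈ X, ∑ j ∈ Yᶜ, pairNorm i j A ^ 2 := by
  let w (p : Λ → Fin 4) (i j : Λ) : ℝ := ‖pauliCoeff p A‖ * (act p i * act p j)
  have hw (p : Λ → Fin 4) (i j : Λ) : 0 ≤ w p i j :=
    mul_nonneg (norm_nonneg _) (mul_nonneg (act_nonneg p i) (act_nonneg p j))
  have hwsum (p : Λ → Fin 4) : 0 ≤ ∑ i ∈ X, ∑ j ∈ Yᶜ, w p i j ^ 2 :=
    sum_nonneg fun i _ => sum_nonneg fun j _ => sq_nonneg _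
  have hcoeff (p : Λ → Fin 4) (hp : ¬ pauliSupp p ⊆ Y) :
      ‖pauliCoeff p A‖ ^ 2 ≤ ∑ i ∈ X, ∑ j ∈ Yᶜ, w p i j ^ 2 := by
    by_cases hpX : pauliSupp p ⊆ Xᶜ
    · have hzero : pauliCoeff p A = 0 := by
        simpa [hA, pauliCoeff_zero, hpX, eq_comm] using pauliCoeff_trunc Xᶜ A p
      rw [hzero, norm_zero, zero_pow two_ne_zero]
      exact hwsum p
    obtain ⟨i, hi, hiX⟩ := not_subset.1 hpX
    obtain ⟨j, hj, hjY⟩ := not_subset.1 hp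
    calc ‖pauliCoeff p A‖ ^ 2
        = w p i j ^ 2 := by
          simp only [w, act_of_ne_zero (mem_pauliSupp.1 hi), act_of_ne_zero (mem_pauliSupp.1 hj),
            mul_one]
      _ ≤ ∑ j ∈ Yᶜ, w p i j ^ 2 :=
          single_le_sum (f := fun j => w p i j ^ 2) (fun _ _ => sq_nonneg _) (mem_compl.2 hjY)
      _ ≤ ∑ i ∈ X, ∑ j ∈ Yᶜ, w p i j ^ 2 :=
          single_le_sum (f := fun i => ∑ j ∈ Yᶜ, w p i j ^ 2)
            (fun _ _ => sum_nonneg fun _ _ => sq_nonneg _) (by simpa using hiX)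
  calc frobNorm (A - trunc Y A) ^ 2
      = ∑ p with ¬ pauliSupp p ⊆ Y, ‖pauliCoeff p A‖ ^ 2 := frobNorm_sub_trunc_sq Y A
    _ ≤ ∑ p with ¬ pauliSupp p ⊆ Y, ∑ i ∈ X, ∑ j ∈ Yᶜ, w p i j ^ 2 :=
        sum_le_sum fun p hp => hcoeff p (mem_filter.1 hp).2
    _ ≤ ∑ p, ∑ i ∈ X, ∑ j ∈ Yᶜ, w p i j ^ 2 :=
        sum_le_sum_of_subset_of_nonneg (filter_subset _ _) fun p _ _ => hwsum p
    _ = ∑ i ∈ X, ∑ j ∈ Yᶜ, ∑ p, w p i j ^ 2 := by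
        rw [sum_comm]
        exact sum_congr rfl fun i _ => sum_comm
    _ ≤ ∑ i ∈ X, ∑ j ∈ Yᶜ, pairNorm i j A ^ 2 :=
        sum_le_sum fun i _ => sum_le_sum fun j _ =>
          sum_sq_le_sq_sum_of_nonneg fun p _ => hw p i j

end PauliWeights

section TimeStep

variable {Λ : Type*} [Fintype Λ] [DecidableEq Λ] {H W : Op Λ} {k : ℕ} {g G s t : ℝ}
  {φ : Λ → Λ → ℝ} {X Y : Finset Λ}

lemma one_third_le_one_sub_sq {x : ℝ} (hx : Real.exp 1 * x < 1) : 1 / 3 ≤ (1 - x) ^ 2 := by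
  have he := Real.exp_one_gt_d9
  have : x ≤ 0.4 := by
    by_contra! h
    nlinarith
  nlinarith

lemma pairNorm_evolve_trunc_compl_le (hH : PauliDecay k g φ H) (hgG : g * k ≤ G) {i : Λ}
    (hi : i ∈ X) (hconv : ∀ j, ∑ l, φ i l * φ l j ≤ G * φ i j) (hs : 0 ≤ s) (hst : s ≤ t)
    (hsmall : 2 * Real.exp 1 * G * t < 1) (j : Λ) :
    pairNorm i j (evolve (trunc Xᶜ H) s (H - trunc Xᶜ H)) ≤ 3 * φ i j := by
  have hG0 : 0 ≤ G :=
    (mul_nonneg ((pairNorm_nonneg i i H).trans (hH.pairNorm_self_le i)) k.cast_nonneg).trans hgG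
  have hx0 : 0 ≤ 2 * G * s := by positivity
  have hx : Real.exp 1 * (2 * G * s) < 1 := by
    calc Real.exp 1 * (2 * G * s) = 2 * Real.exp 1 * G * s := by ring
      _ ≤ 2 * Real.exp 1 * G * t := by gcongr
      _ < 1 := hsmall
  have hx1 : 2 * G * s < 1 := (le_mul_of_one_le_left hx0 (Real.one_le_exp zero_le_one)).trans_lt hx
  have hsq := one_third_le_one_sub_sq hx
  have hoff : ∀ p, p i ≠ 0 → pauliCoeff p (trunc Xᶜ H) = 0 := fun p hp =>
    (supportedOn_trunc Xᶜ H).pauliCoeff_eq_zero fun h =>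
      mem_compl.1 (h (mem_pauliSupp.2 hp)) hi
  refine (pairNorm_evolve_le (hH.mono (norm_pauliCoeff_trunc_le _ _)) hoff
    (hH.mono (norm_pauliCoeff_sub_trunc_le _ _)) hgG hconv hs hx1 j).trans ?_
  rw [div_le_iff₀ (by linarith)]
  nlinarith [hH.nonneg i j]

lemma trunc_compl_evolve_sub_trunc (H : Op Λ) (X : Finset Λ) (s : ℝ) :
    trunc Xᶜ (evolve (trunc Xᶜ H) s (H - trunc Xᶜ H)) = 0 := by
  rw [trunc_evolve (supportedOn_trunc _ _), map_sub, trunc_eq_self (supportedOn_trunc _ _),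
    sub_self, evolve, mul_zero, zero_mul]

lemma frobNorm_evolve_sub_trunc_le_sqrt (hH : H.IsHermitian) (hdecay : PauliDecay k g φ H)
    (hgG : g * k ≤ G) (hconv : ∀ i j, ∑ l, φ i l * φ l j ≤ G * φ i j)
    (hW : SupportedOn X W) (hXY : X ⊆ Y) (hW1 : opNorm W ≤ 1) (ht : 0 ≤ t)
    (hsmall : 2 * Real.exp 1 * G * t < 1) :
    frobNorm (evolve H t W - trunc Y (evolve H t W)) ≤
      6 * t * √(∑ i ∈ X, ∑ j ∈ Yᶜ, φ i j ^ 2) := by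
  set S := ∑ i ∈ X, ∑ j ∈ Yᶜ, φ i j ^ 2
  have hleak : ∀ s, 0 ≤ s → s ≤ t → frobNorm (evolve (trunc Xᶜ H) s (H - trunc Xᶜ H) -
      trunc Y (evolve (trunc Xᶜ H) s (H - trunc Xᶜ H))) ≤ 3 * √S := by
    intro s hs hst
    rw [← abs_of_nonneg (frobNorm_nonneg _), ← abs_of_nonneg (by positivity : 0 ≤ 3 * √S),
      ← sq_le_sq, mul_pow, Real.sq_sqrt (sum_nonneg fun _ _ => sum_nonneg fun _ _ => sq_nonneg _)]
    refine (frobNorm_sub_trunc_sq_le (trunc_compl_evolve_sub_trunc H X s) Y).trans ?_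
    simp only [mul_sum, ← mul_pow]
    exact sum_le_sum fun i hi => sum_le_sum fun j _ => pow_le_pow_left₀ (pairNorm_nonneg _ _ _)
      (pairNorm_evolve_trunc_compl_le hdecay hgG hi (hconv i) hs hst hsmall j) 2
  refine (frobNorm_evolve_sub_trunc_le hH (isHermitian_trunc hH _) (supportedOn_trunc _ _) hW hXY
    hW1 ht hleak).trans_eq ?_
  ring

end TimeStep

section PowerLaw

variable {Λ : Type*} [Fintype Λ] {G : SimpleGraph Λ} {h : Finset Λ → Op Λ} {k : ℕ}
  {α J₀ g lam : ℝ}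

lemma IsConvConst.one_le [Nonempty Λ] (hl : IsConvConst G α lam) : 1 ≤ lam := by
  obtain ⟨i⟩ := ‹Nonempty Λ›
  have hterm := single_le_sum (f := fun j => ((G.dist i j : ℝ) + 1) ^ (-α) *
    ((G.dist j i : ℝ) + 1) ^ (-α)) (fun j _ => by positivity) (mem_univ i)
  simpa using hterm.trans (hl i i)

variable [DecidableEq Λ]

lemma IsPowerLaw.sum_norm_pauliCoeff_le (hP : IsPowerLaw G h k α J₀) (Z : Finset Λ) :
    ∑ p, ‖pauliCoeff p (h Z)‖ ≤ pauliBase h ^ ((k : ℝ) / 2) * opNorm (h Z) := by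
  have hb := one_le_pauliBase h
  by_cases hk : k < #Z
  · simpa only [hP.klocal Z hk, pauliCoeff_zero, norm_zero, sum_const_zero] using
      mul_nonneg (Real.rpow_nonneg (by linarith) _) (opNorm_nonneg _)
  obtain ⟨s, hs, hcard⟩ := exists_card_eq_pauliBase_pow (hP.supported Z)
  have hsqrt : √(#s) ≤ pauliBase h ^ ((k : ℝ) / 2) := by
    rw [hcard, Real.sqrt_eq_rpow, ← Real.rpow_natCast, ← Real.rpow_mul (by linarith),
      mul_one_div]
    gcongr
    exact not_lt.1 hk
  calc ∑ p, ‖pauliCoeff p (h Z)‖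
      ≤ √(#s) * frobNorm (h Z) := LongRange.sum_norm_pauliCoeff_le hs
    _ ≤ pauliBase h ^ ((k : ℝ) / 2) * opNorm (h Z) :=
        mul_le_mul hsqrt (frobNorm_le_opNorm _) (frobNorm_nonneg _) (by positivity)

lemma SupportedOn.pairNorm_eq_zero {Z : Finset Λ} {A : Op Λ} (hA : SupportedOn Z A) {i j : Λ}
    (hij : ¬ (i ∈ Z ∧ j ∈ Z)) : pairNorm i j A = 0 := by
  refine sum_eq_zero fun p _ => ?_
  by_cases hi : i ∈ Z
  · rw [mul_left_comm, hA.norm_pauliCoeff_mul_act (fun hj => hij ⟨hi, hj⟩), mul_zero]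
  · rw [← mul_assoc, hA.norm_pauliCoeff_mul_act hi, zero_mul]

lemma pairNorm_le_sum_norm_pauliCoeff (i j : Λ) (A : Op Λ) :
    pairNorm i j A ≤ ∑ p, ‖pauliCoeff p A‖ :=
  sum_le_sum fun p _ => mul_le_of_le_one_right (norm_nonneg _)
    (mul_le_one₀ (act_le_one p i) (act_nonneg p j) (act_le_one p j))

lemma IsPowerLaw.pairNorm_hamiltonian_le_sum (hP : IsPowerLaw G h k α J₀) (i j : Λ) :
    pairNorm i j (hamiltonian h) ≤ ∑ Z with i ∈ Z ∧ j ∈ Z, pairNorm i j (h Z) := by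
  rw [sum_filter_of_ne fun Z _ hne => not_imp_comm.1 (hP.supported Z).pairNorm_eq_zero hne]
  exact pairNorm_sum_le _ _ _ _

lemma IsPowerLaw.pairNorm_hamiltonian_self_le (hP : IsPowerLaw G h k α J₀)
    (hg : IsSiteEnergy h g) (i : Λ) : pairNorm i i (hamiltonian h) ≤ g := by
  refine (hP.pairNorm_hamiltonian_le_sum i i).trans (le_of_eq_of_le ?_ (hg i))
  simp only [and_self, pairNorm_self]
  refine sum_congr rfl fun Z _ => ?_
  simp only [sum_filter, act, mul_ite, mul_zero, mul_one, ite_not]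

lemma IsPowerLaw.pairNorm_hamiltonian_le (hP : IsPowerLaw G h k α J₀) (i j : Λ) :
    pairNorm i j (hamiltonian h) ≤
      pauliBase h ^ ((k : ℝ) / 2) * J₀ * ((G.dist i j : ℝ) + 1) ^ (-α) := by
  have hb := one_le_pauliBase h
  calc pairNorm i j (hamiltonian h)
      ≤ ∑ Z with i ∈ Z ∧ j ∈ Z, pauliBase h ^ ((k : ℝ) / 2) * opNorm (h Z) :=
        (hP.pairNorm_hamiltonian_le_sum i j).trans <| sum_le_sum fun Z _ =>
          (pairNorm_le_sum_norm_pauliCoeff i j _).trans (hP.sum_norm_pauliCoeff_le Z)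
    _ ≤ pauliBase h ^ ((k : ℝ) / 2) * (J₀ * ((G.dist i j : ℝ) + 1) ^ (-α)) := by
        rw [← mul_sum]
        exact mul_le_mul_of_nonneg_left (hP.decay i j) (by positivity)
    _ = _ := (mul_assoc _ _ _).symm

lemma IsPowerLaw.degreeLE_hamiltonian (hP : IsPowerLaw G h k α J₀) :
    DegreeLE k (hamiltonian h) := by
  intro q hq
  rw [hamiltonian, pauliCoeff_sum]
  refine sum_eq_zero fun Z _ => ?_
  by_cases hZ : pauliSupp q ⊆ Z
  · rw [hP.klocal Z (hq.trans_le (card_le_card hZ)), pauliCoeff_zero]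
  · exact (hP.supported Z).pauliCoeff_eq_zero hZ

lemma IsPowerLaw.isHermitian_hamiltonian (hP : IsPowerLaw G h k α J₀) :
    (hamiltonian h).IsHermitian := by
  rw [Matrix.IsHermitian, hamiltonian, Matrix.conjTranspose_sum]
  exact sum_congr rfl fun Z _ => (hP.hermitian Z).eq

lemma IsPowerLaw.pauliDecay (hP : IsPowerLaw G h k α J₀) (hg : IsSiteEnergy h g) :
    PauliDecay k g (fun i j => pauliBase h ^ ((k : ℝ) / 2) * J₀ * ((G.dist i j : ℝ) + 1) ^ (-α))
      (hamiltonian h) where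
  degreeLE := hP.degreeLE_hamiltonian
  pairNorm_self_le := hP.pairNorm_hamiltonian_self_le hg
  pairNorm_le := hP.pairNorm_hamiltonian_le

variable [Nonempty Λ]

lemma IsPowerLaw.nonneg (hP : IsPowerLaw G h k α J₀) : 0 ≤ J₀ := by
  obtain ⟨i⟩ := ‹Nonempty Λ›
  simpa using (sum_nonneg fun Z _ => opNorm_nonneg (h Z)).trans (hP.decay i i)

lemma IsPowerLaw.pauliBase_rpow_mul_nonneg (hP : IsPowerLaw G h k α J₀) :
    0 ≤ pauliBase h ^ ((k : ℝ) / 2) * J₀ :=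
  mul_nonneg (Real.rpow_nonneg (zero_le_one.trans (one_le_pauliBase h)) _) hP.nonneg

lemma IsPowerLaw.pauliBase_rpow_mul_le_gTilde (hP : IsPowerLaw G h k α J₀)
    (hl : IsConvConst G α lam) (g : ℝ) :
    pauliBase h ^ ((k : ℝ) / 2) * J₀ ≤ gTilde h k J₀ lam g :=
  (le_mul_of_one_le_left hP.pauliBase_rpow_mul_nonneg hl.one_le).trans (le_max_right _ _)

lemma IsPowerLaw.gTilde_nonneg (hP : IsPowerLaw G h k α J₀) (hl : IsConvConst G α lam) (g : ℝ) :
    0 ≤ gTilde h k J₀ lam g :=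
  hP.pauliBase_rpow_mul_nonneg.trans (hP.pauliBase_rpow_mul_le_gTilde hl g)

lemma IsPowerLaw.frobNorm_evolve_sub_trunc_le (hP : IsPowerLaw G h k α J₀)
    (hl : IsConvConst G α lam) (hg : IsSiteEnergy h g) {X Y : Finset Λ} {W : Op Λ}
    (hW : SupportedOn X W) (hXY : X ⊆ Y) (hW1 : opNorm W ≤ 1) {t : ℝ} (ht : 0 ≤ t)
    (hsmall : 2 * Real.exp 1 * gTilde h k J₀ lam g * t < 1) :
    frobNorm (evolve (hamiltonian h) t W - trunc Y (evolve (hamiltonian h) t W)) ≤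
      6 * gTilde h k J₀ lam g * t *
        √(∑ i ∈ X, ∑ j ∈ Yᶜ, (((G.dist i j : ℝ) + 1) ^ (-α)) ^ 2) := by
  set J := pauliBase h ^ ((k : ℝ) / 2) * J₀ with hJ
  set Gt := gTilde h k J₀ lam g with hGt
  let δ (i j : Λ) : ℝ := ((G.dist i j : ℝ) + 1) ^ (-α)
  have hJ0 : 0 ≤ J := hP.pauliBase_rpow_mul_nonneg
  have hJG : J ≤ Gt := hP.pauliBase_rpow_mul_le_gTilde hl g
  have hG0 : 0 ≤ Gt := hP.gTilde_nonneg hl g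
  have hconv (i j : Λ) : ∑ l, J * δ i l * (J * δ l j) ≤ Gt * (J * δ i j) := by
    calc ∑ l, J * δ i l * (J * δ l j)
        = J * (J * ∑ l, δ i l * δ l j) := by
          simp only [mul_sum]
          exact sum_congr rfl fun l _ => by ring
      _ ≤ J * (J * (lam * δ i j)) := by
          gcongr
          exact hl i j
      _ = lam * J * (J * δ i j) := by ring
      _ ≤ Gt * (J * δ i j) := mul_le_mul_of_nonneg_right (le_max_right _ _) (by positivity)
  calc frobNorm (evolve (hamiltonian h) t W - trunc Y (evolve (hamiltonian h) t W))
      ≤ 6 * t * √(∑ i ∈ X, ∑ j ∈ Yᶜ, (J * δ i j) ^ 2) :=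
        frobNorm_evolve_sub_trunc_le_sqrt hP.isHermitian_hamiltonian (hP.pauliDecay hg)
          (le_max_left _ _) hconv hW hXY hW1 ht hsmall
    _ = 6 * t * (J * √(∑ i ∈ X, ∑ j ∈ Yᶜ, δ i j ^ 2)) := by
        simp only [mul_pow, ← mul_sum]
        rw [Real.sqrt_mul (sq_nonneg J), Real.sqrt_sq hJ0]
    _ ≤ 6 * t * (Gt * √(∑ i ∈ X, ∑ j ∈ Yᶜ, δ i j ^ 2)) := by gcongr
    _ = 6 * Gt * t * √(∑ i ∈ X, ∑ j ∈ Yᶜ, δ i j ^ 2) := by ring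

end PowerLaw

section Geometry

lemma sum_range_rpow_le {s b : ℝ} (hs : 0 < s) (hb : 0 < b) (n : ℕ) :
    ∑ u ∈ range n, (b + u + 1) ^ (-(s + 1)) ≤ b ^ (-s) / s := by
  have hanti : AntitoneOn (fun x : ℝ => x ^ (-(s + 1))) (Set.Icc b (b + n)) :=
    fun x hx y _ hxy => Real.rpow_le_rpow_of_nonpos (hb.trans_le hx.1) hxy (by linarith)
  have hmem : (0 : ℝ) ∉ Set.uIcc b (b + n) := by
    rw [Set.uIcc_of_le (by simp)]
    exact fun h0 => hb.not_ge h0.1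
  calc ∑ u ∈ range n, (b + u + 1) ^ (-(s + 1))
      = ∑ u ∈ range n, (b + (u + 1 : ℕ)) ^ (-(s + 1)) := by push_cast; simp only [add_assoc]
    _ ≤ ∫ x in b..b + n, x ^ (-(s + 1)) := hanti.sum_le_integral
    _ = (b ^ (-s) - (b + n) ^ (-s)) / s := by
        rw [integral_rpow (Or.inr ⟨by linarith, hmem⟩), show -(s + 1) + 1 = -s by ring, div_neg,
          ← neg_div, neg_sub]
    _ ≤ b ^ (-s) / s := by
        gcongr
        exact sub_le_self _ (by positivity)

variable {Λ : Type*} [Fintype Λ] {G : SimpleGraph Λ} {D : ℕ} {α γ : ℝ}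

lemma mem_ball {i j : Λ} {r : ℕ} : j ∈ ball G i r ↔ G.dist i j ≤ r := by
  simp [ball]

lemma mem_ball_self (i : Λ) (r : ℕ) : i ∈ ball G i r := by
  simp [mem_ball]

lemma ball_mono (i : Λ) {r R : ℕ} (hrR : r ≤ R) : ball G i r ⊆ ball G i R :=
  fun _ hj => mem_ball.2 ((mem_ball.1 hj).trans hrR)

lemma mem_sphere {i j : Λ} {r : ℕ} : j ∈ sphere G i r ↔ G.dist i j = r := by
  simp [sphere]

lemma IsLattice.sphere_zero (hG : IsLattice G D γ) (i : Λ) : sphere G i 0 = {i} := by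
  ext j
  rw [mem_sphere, hG.connected.dist_eq_zero_iff, mem_singleton, eq_comm]

lemma IsLattice.card_sphere_le_of_le (hG : IsLattice G D γ) (hD : 1 ≤ D) (i : Λ) {r : ℕ} {x : ℝ}
    (hx : 1 ≤ x) (hrx : r ≤ x) : (#(sphere G i r) : ℝ) ≤ γ * x ^ ((D : ℝ) - 1) := by
  rw [← Nat.cast_pred hD, Real.rpow_natCast]
  have hγ := hG.one_le
  rcases r.eq_zero_or_pos with rfl | hr
  · rw [hG.sphere_zero, card_singleton, Nat.cast_one]
    exact one_le_mul_of_one_le_of_one_le hγ (one_le_pow₀ hx)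
  · refine (hG.card_sphere i r hr).trans ?_
    gcongr

/-- Applied with `f` a distance, this turns a sum over sites into a one-dimensional sum. -/
lemma sum_comp_le_sum_range {ι : Type*} {s : Finset ι} {f : ι → ℕ} {n : ℕ} {φ : ℕ → ℝ} {c : ℕ → ℝ}
    (hf : ∀ i ∈ s, f i < n) (hφ : ∀ l, 0 ≤ φ l) (hc : ∀ l < n, #{i ∈ s | f i = l} ≤ c l) :
    ∑ i ∈ s, φ (f i) ≤ ∑ l ∈ range n, c l * φ l := by
  rw [← sum_fiberwise_of_maps_to fun i hi => mem_range.2 (hf i hi)]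
  refine sum_le_sum fun l hl => ?_
  rw [sum_congr rfl fun i hi => by rw [(mem_filter.1 hi).2], sum_const, nsmul_eq_mul]
  exact mul_le_mul_of_nonneg_right (hc l (mem_range.1 hl)) (hφ l)

lemma IsLattice.sum_far_le (hG : IsLattice G D γ) (hD : 1 ≤ D) {s : ℝ} (hs : 0 < s) (i : Λ)
    (b : ℕ) : ∑ j with b < G.dist i j, ((G.dist i j : ℝ) + 1) ^ (-(s + D)) ≤
      γ * ((b : ℝ) + 1) ^ (-s) / s := by
  have hγ : 0 ≤ γ := zero_le_one.trans hG.one_le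
  set n := univ.sup (G.dist i) + 1
  have hlt : ∀ j, G.dist i j < n := fun j => Nat.lt_succ_of_le (le_sup (mem_univ j))
  calc ∑ j with b < G.dist i j, ((G.dist i j : ℝ) + 1) ^ (-(s + D))
      = ∑ j with b < G.dist i j,
          ((b : ℝ) + 1 + (G.dist i j - (b + 1) : ℕ) + 1) ^ (-(s + D)) :=
        sum_congr rfl fun j hj => by
          rw [Nat.cast_sub (mem_filter.1 hj).2]
          push_cast
          ring_nf
    _ ≤ ∑ u ∈ range n, γ * ((b : ℝ) + 1 + u + 1) ^ ((D : ℝ) - 1) *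
          ((b : ℝ) + 1 + u + 1) ^ (-(s + D)) := by
        refine sum_comp_le_sum_range (φ := fun u => ((b : ℝ) + 1 + u + 1) ^ (-(s + D)))
          (fun j _ => (Nat.sub_le _ _).trans_lt (hlt j)) (fun u => by positivity) fun u _ => ?_
        refine le_trans (Nat.cast_le.2 (card_le_card fun j hj => ?_))
          (hG.card_sphere_le_of_le hD i (r := b + 1 + u) (by linarith) (by push_cast; linarith))
        simp only [mem_filter, mem_univ, true_and, mem_sphere] at hj ⊢
        omega
    _ = γ * ∑ u ∈ range n, ((b : ℝ) + 1 + u + 1) ^ (-(s + 1)) := by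
        rw [mul_sum]
        refine sum_congr rfl fun u _ => ?_
        rw [mul_assoc, ← Real.rpow_add (by positivity)]
        ring_nf
    _ ≤ γ * (((b : ℝ) + 1) ^ (-s) / s) := by
        gcongr
        exact sum_range_rpow_le hs (by positivity) n
    _ = γ * ((b : ℝ) + 1) ^ (-s) / s := (mul_div_assoc _ _ _).symm

variable [DecidableEq Λ]

/-- A site `a` at depth `r - d(i, a)` inside the ball is at distance more than `r - d(i, a) + δ`
from the complement of the larger ball. -/
lemma IsLattice.sum_compl_ball_le (hG : IsLattice G D γ) (hD : 1 ≤ D) (hα : (D : ℝ) < 2 * α)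
    {i a : Λ} {r : ℕ} (ha : a ∈ ball G i r) (δ : ℕ) :
    ∑ j ∈ (ball G i (r + δ))ᶜ, (((G.dist a j : ℝ) + 1) ^ (-α)) ^ 2 ≤
      γ * ((δ : ℝ) + (r - G.dist i a : ℕ) + 1) ^ (-(2 * α - D)) / (2 * α - D) := by
  have hexp : ∀ j, (((G.dist a j : ℝ) + 1) ^ (-α)) ^ 2 =
      ((G.dist a j : ℝ) + 1) ^ (-(2 * α - D + D)) := fun j => by
    rw [← Real.rpow_mul_natCast (by positivity)]
    push_cast
    ring_nf
  simp only [hexp]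
  refine (sum_le_sum_of_subset_of_nonneg (fun j hj => ?_) fun j _ _ => by positivity).trans
    ((hG.sum_far_le hD (sub_pos.2 hα) a (δ + (r - G.dist i a))).trans_eq (by push_cast; rfl))
  have htri := hG.connected.dist_triangle (u := i) (v := a) (w := j)
  simp only [mem_compl, mem_ball, mem_filter, mem_univ, true_and] at hj ha ⊢
  omega

lemma IsLattice.sum_ball_sum_compl_ball_le (hG : IsLattice G D γ) (hD : 1 ≤ D)
    (hα : (D : ℝ) + 1 < 2 * α) (i : Λ) {r δ R : ℕ} (hδ : 1 ≤ δ) (hR : r + δ ≤ R) :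
    ∑ a ∈ ball G i r, ∑ j ∈ (ball G i (r + δ))ᶜ, (((G.dist a j : ℝ) + 1) ^ (-α)) ^ 2 ≤
      γ ^ 2 * (R : ℝ) ^ ((D : ℝ) - 1) * (δ : ℝ) ^ (-(2 * α - D - 1)) /
        ((2 * α - D) * (2 * α - D - 1)) := by
  have hγ : 0 ≤ γ := zero_le_one.trans hG.one_le
  have hs : 0 < 2 * α - D - 1 := by linarith
  have hs' : 0 < 2 * α - D := by linarith
  have hsphere : ∀ l < r + 1, (#{a ∈ ball G i r | r - G.dist i a = l} : ℝ) ≤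
      γ * (R : ℝ) ^ ((D : ℝ) - 1) := by
    intro l hl
    refine le_trans (Nat.cast_le.2 (card_le_card fun a ha => ?_))
      (hG.card_sphere_le_of_le hD i (r := r - l) (by exact_mod_cast (by omega : 1 ≤ R))
        (by exact_mod_cast (by omega : r - l ≤ R)))
    simp only [mem_filter, mem_ball, mem_sphere] at ha ⊢
    omega
  calc ∑ a ∈ ball G i r, ∑ j ∈ (ball G i (r + δ))ᶜ, (((G.dist a j : ℝ) + 1) ^ (-α)) ^ 2
      ≤ ∑ a ∈ ball G i r,
          γ * ((δ : ℝ) + (r - G.dist i a : ℕ) + 1) ^ (-(2 * α - D)) / (2 * α - D) :=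
        sum_le_sum fun a ha => hG.sum_compl_ball_le hD (by linarith) ha δ
    _ ≤ ∑ l ∈ range (r + 1), γ * (R : ℝ) ^ ((D : ℝ) - 1) *
          (γ * ((δ : ℝ) + l + 1) ^ (-(2 * α - D)) / (2 * α - D)) :=
        sum_comp_le_sum_range (φ := fun l => γ * ((δ : ℝ) + l + 1) ^ (-(2 * α - D)) / (2 * α - D))
          (fun a _ => by omega) (fun l => by positivity) hsphere
    _ = γ * (R : ℝ) ^ ((D : ℝ) - 1) * (γ / (2 * α - D)) *
          ∑ l ∈ range (r + 1), ((δ : ℝ) + l + 1) ^ (-((2 * α - D - 1) + 1)) := by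
        rw [mul_sum, sub_add_cancel]
        exact sum_congr rfl fun l _ => by ring
    _ ≤ γ * (R : ℝ) ^ ((D : ℝ) - 1) * (γ / (2 * α - D)) *
          ((δ : ℝ) ^ (-(2 * α - D - 1)) / (2 * α - D - 1)) := by
        gcongr
        exact sum_range_rpow_le hs (by positivity) _
    _ = _ := by field_simp

end Geometry

section Convolution

lemma rpow_neg_le_two_rpow_mul {r R s : ℝ} (hr : 0 < r) (hs : 0 ≤ s) (hrR : r ≤ 2 * R) :
    R ^ (-s) ≤ 2 ^ s * r ^ (-s) := by
  calc R ^ (-s) ≤ (r / 2) ^ (-s) :=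
        Real.rpow_le_rpow_of_nonpos (by positivity) (by linarith) (by linarith)
    _ = 2 ^ s * r ^ (-s) := by
        rw [Real.div_rpow hr.le zero_le_two, Real.rpow_neg zero_le_two, div_inv_eq_mul, mul_comm]

variable {Λ : Type*} {G : SimpleGraph Λ} {D : ℕ} {α γ : ℝ}

/-- At least one of the two distances is at least half of `d(i, i')`. -/
lemma dist_rpow_mul_dist_rpow_le (hG : G.Connected) (hα : 0 ≤ α) (i j i' : Λ) :
    ((G.dist i j : ℝ) + 1) ^ (-α) * ((G.dist j i' : ℝ) + 1) ^ (-α) ≤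
      2 ^ α * ((G.dist i i' : ℝ) + 1) ^ (-α) *
        (((G.dist i j : ℝ) + 1) ^ (-α) + ((G.dist i' j : ℝ) + 1) ^ (-α)) := by
  have htri : (G.dist i i' : ℝ) ≤ G.dist i j + G.dist j i' := by exact_mod_cast hG.dist_triangle
  have hhalf : ∀ x : ℝ, (G.dist i i' : ℝ) + 1 ≤ 2 * x →
      x ^ (-α) ≤ 2 ^ α * ((G.dist i i' : ℝ) + 1) ^ (-α) :=
    fun x hx => rpow_neg_le_two_rpow_mul (by positivity) hα hx
  rw [G.dist_comm (u := i') (v := j), mul_add]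
  rcases le_total (G.dist i j : ℝ) (G.dist j i') with hle | hle
  · rw [mul_comm]
    exact le_add_of_le_of_nonneg (by gcongr; exact hhalf _ (by linarith)) (by positivity)
  · exact le_add_of_nonneg_of_le (by positivity) (by gcongr; exact hhalf _ (by linarith))

variable [Fintype Λ]

/-- A convolution constant `λ` depending on the lattice parameters only; see
`IsLattice.isConvConst`. -/
def convConst (D : ℕ) (α γ : ℝ) : ℝ := 2 ^ (α + 1) * (1 + γ / (α - D))

lemma IsLattice.sum_dist_le (hG : IsLattice G D γ) (hD : 1 ≤ D) (hα : (D : ℝ) < α) (i : Λ) :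
    ∑ j, ((G.dist i j : ℝ) + 1) ^ (-α) ≤ 1 + γ / (α - D) := by
  have hfar := hG.sum_far_le hD (sub_pos.2 hα) i 0
  have hnear : ({j | ¬0 < G.dist i j} : Finset Λ) = {i} := by
    rw [← hG.sphere_zero i, sphere]
    exact filter_congr fun j _ => Nat.pos_iff_ne_zero.not_left
  rw [sub_add_cancel, Nat.cast_zero, zero_add, Real.one_rpow, mul_one] at hfar
  rw [← sum_filter_not_add_sum_filter univ (0 < G.dist i ·), hnear, sum_singleton]
  simpa using hfar

lemma IsLattice.isConvConst (hG : IsLattice G D γ) (hD : 1 ≤ D) (hα : (D : ℝ) < α) :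
    IsConvConst G α (convConst D α γ) := by
  intro i i'
  have hα0 : 0 ≤ α := (Nat.cast_nonneg D).trans hα.le
  calc ∑ j, ((G.dist i j : ℝ) + 1) ^ (-α) * ((G.dist j i' : ℝ) + 1) ^ (-α)
      ≤ 2 ^ α * ((G.dist i i' : ℝ) + 1) ^ (-α) *
          (∑ j, ((G.dist i j : ℝ) + 1) ^ (-α) + ∑ j, ((G.dist i' j : ℝ) + 1) ^ (-α)) := by
        rw [← sum_add_distrib, mul_sum]
        exact sum_le_sum fun j _ => dist_rpow_mul_dist_rpow_le hG.connected hα0 i j i'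
    _ ≤ 2 ^ α * ((G.dist i i' : ℝ) + 1) ^ (-α) * ((1 + γ / (α - D)) + (1 + γ / (α - D))) := by
        gcongr
        exacts [hG.sum_dist_le hD hα i, hG.sum_dist_le hD hα i']
    _ = convConst D α γ * ((G.dist i i' : ℝ) + 1) ^ (-α) := by
        rw [convConst, Real.rpow_add_one two_ne_zero]
        ring

end Convolution

section Approximation

variable {Λ : Type*} [Fintype Λ] [DecidableEq Λ] {G : SimpleGraph Λ} {h : Finset Λ → Op Λ}
  {D k : ℕ} {α γ J₀ lam g t : ℝ}

lemma IsPowerLaw.frobNorm_evolve_sub_trunc_ball_le (hP : IsPowerLaw G h k α J₀)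
    (hl : IsConvConst G α lam) (hg : IsSiteEnergy h g) (hG : IsLattice G D γ) (hD : 1 ≤ D)
    (hα : (D : ℝ) < α) (ht : 0 ≤ t) (hsmall : 2 * Real.exp 1 * gTilde h k J₀ lam g * t < 1)
    {i : Λ} {r δ R : ℕ} (hδ : 1 ≤ δ) (hR : r + δ ≤ R) {W : Op Λ} (hW : SupportedOn (ball G i r) W)
    (hW1 : opNorm W ≤ 1) :
    frobNorm (evolve (hamiltonian h) t W -
        trunc (ball G i (r + δ)) (evolve (hamiltonian h) t W)) ≤
      3 * gTilde h k J₀ lam g * γ / (α - D) * t *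
        ((R : ℝ) ^ (((D : ℝ) - 1) / 2) * (δ : ℝ) ^ (-α + ((D : ℝ) + 1) / 2)) := by
  have : Nonempty Λ := ⟨i⟩
  have hD' : (1 : ℝ) ≤ D := by exact_mod_cast hD
  have hγ : 0 ≤ γ := zero_le_one.trans hG.one_le
  have hgt := hP.gTilde_nonneg hl g
  have hαD : 0 < α - D := sub_pos.2 hα
  set Q := (R : ℝ) ^ (((D : ℝ) - 1) / 2) * (δ : ℝ) ^ (-α + ((D : ℝ) + 1) / 2) with hQ
  have hQsq : Q ^ 2 = (R : ℝ) ^ ((D : ℝ) - 1) * (δ : ℝ) ^ (-(2 * α - D - 1)) := by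
    rw [hQ, mul_pow, ← Real.rpow_mul_natCast (Nat.cast_nonneg R),
      ← Real.rpow_mul_natCast (Nat.cast_nonneg δ)]
    push_cast
    ring_nf
  have hsum : √(∑ a ∈ ball G i r, ∑ j ∈ (ball G i (r + δ))ᶜ,
      (((G.dist a j : ℝ) + 1) ^ (-α)) ^ 2) ≤ γ / (2 * (α - D)) * Q := by
    refine Real.sqrt_le_iff.2 ⟨by positivity, ?_⟩
    refine (hG.sum_ball_sum_compl_ball_le hD (by linarith) i hδ hR).trans ?_
    rw [mul_assoc, ← hQsq, mul_pow (γ / _), div_pow, div_mul_eq_mul_div]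
    refine div_le_div_of_nonneg_left (by positivity) (by positivity) ?_
    nlinarith
  refine (hP.frobNorm_evolve_sub_trunc_le hl hg hW (ball_mono i (Nat.le_add_right r δ)) hW1 ht
    hsmall).trans ((mul_le_mul_of_nonneg_left hsum (by positivity)).trans_eq ?_)
  field_simp
  ring

lemma IsPowerLaw.exists_local_approximation_steps (hP : IsPowerLaw G h k α J₀)
    (hl : IsConvConst G α lam) (hg : IsSiteEnergy h g) (hG : IsLattice G D γ) (hD : 1 ≤ D)
    (hα : (D : ℝ) < α) (ht : 0 ≤ t) (hsmall : 2 * Real.exp 1 * gTilde h k J₀ lam g * t < 1)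
    {i : Λ} {δ R n : ℕ} (hδ : 1 ≤ δ) (hR : n * δ ≤ R) {W : Op Λ} (hW : SupportedOn {i} W)
    (hW1 : opNorm W ≤ 1) :
    ∃ W' : Op Λ, SupportedOn (ball G i (n * δ)) W' ∧ opNorm W' ≤ 1 ∧
      frobNorm (evolve (hamiltonian h) (n * t) W - W') ≤
        n * (3 * gTilde h k J₀ lam g * γ / (α - D) * t *
          ((R : ℝ) ^ (((D : ℝ) - 1) / 2) * (δ : ℝ) ^ (-α + ((D : ℝ) + 1) / 2))) := by
  set H := hamiltonian h
  have hH : H.IsHermitian := hP.isHermitian_hamiltonian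
  induction n with
  | zero => exact ⟨W, hW.mono (by simp [mem_ball_self]), hW1, by simp [evolve_zero, frobNorm_zero]⟩
  | succ n ih =>
    rw [Nat.succ_mul] at hR ⊢
    obtain ⟨W₁, hW₁, hnorm, herr⟩ := ih (by omega)
    refine ⟨trunc (ball G i (n * δ + δ)) (evolve H t W₁), supportedOn_trunc _ _,
      (opNorm_trunc_le _ _).trans ((opNorm_evolve hH t W₁).trans_le hnorm), ?_⟩
    have hsplit : evolve H ((n + 1 : ℕ) * t) W - trunc (ball G i (n * δ + δ)) (evolve H t W₁) =
        evolve H t (evolve H (n * t) W - W₁) +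
          (evolve H t W₁ - trunc (ball G i (n * δ + δ)) (evolve H t W₁)) := by
      rw [evolve_map_sub, sub_add_sub_cancel, ← evolve_add]
      push_cast
      ring_nf
    have hstep := hP.frobNorm_evolve_sub_trunc_ball_le hl hg hG hD hα ht hsmall hδ hR hW₁ hnorm
    have hold := (frobNorm_evolve_le hH t (evolve H (n * t) W - W₁)).trans herr
    rw [hsplit]
    refine (frobNorm_add_le _ _).trans ((add_le_add hold hstep).trans_eq ?_)
    push_cast
    ring

lemma mul_rpow_mul_rpow_div_eq {R Δt t a D : ℝ} (hR : 0 < R) (hΔ : 0 ≤ Δt) (ht : 0 < t) :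
    t * (R ^ ((D - 1) / 2) * (R * Δt / t) ^ (-a + (D + 1) / 2)) =
      Δt ^ (-a + (D + 1) / 2) * t ^ (a - (D - 1) / 2) * R ^ (-a + D) := by
  have hRpow : R ^ (-a + D) = R ^ ((D - 1) / 2) * R ^ (-a + (D + 1) / 2) := by
    rw [← Real.rpow_add hR]
    ring_nf
  have htpow : t ^ (a - (D - 1) / 2) = t * (t ^ (-a + (D + 1) / 2))⁻¹ := by
    rw [← Real.rpow_neg ht.le, show a - (D - 1) / 2 = 1 + -(-a + (D + 1) / 2) by ring,
      Real.rpow_add ht, Real.rpow_one]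
  rw [Real.div_rpow (by positivity) ht.le, Real.mul_rpow hR.le hΔ, hRpow, htpow]
  ring

lemma IsPowerLaw.exists_local_approximation (hP : IsPowerLaw G h k α J₀)
    (hl : IsConvConst G α lam) (hg : IsSiteEnergy h g) (hG : IsLattice G D γ) (hD : 1 ≤ D)
    (hα : (D : ℝ) < α) {Δt : ℝ} (ht : 0 < t) (hΔ : 0 < Δt)
    (hsmall : 2 * Real.exp 1 * gTilde h k J₀ lam g * Δt < 1) {m R : ℕ} (hm : t / Δt = m)
    (hR : 0 < R) (hmR : m ∣ R) {i : Λ} {W : Op Λ} (hW : SupportedOn {i} W) (hW1 : opNorm W ≤ 1) :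
    ∃ W' : Op Λ, SupportedOn (ball G i R) W' ∧
      frobNorm (evolve (hamiltonian h) t W - W') ≤ 3 * gTilde h k J₀ lam g * γ / (α - D) *
        Δt ^ (-α + ((D : ℝ) + 1) / 2) * t ^ (α - ((D : ℝ) - 1) / 2) * (R : ℝ) ^ (-α + D) := by
  obtain ⟨δ, rfl⟩ := hmR
  have hmt : (m : ℝ) * Δt = t := by rw [← hm, div_mul_cancel₀ _ hΔ.ne']
  have hδ : (δ : ℝ) = (m * δ : ℕ) * Δt / t := by
    rw [eq_div_iff ht.ne', ← hmt]
    push_cast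
    ring
  obtain ⟨W', hsupp, -, herr⟩ := hP.exists_local_approximation_steps hl hg hG hD hα hΔ.le hsmall
    (Nat.pos_of_mul_pos_left hR) le_rfl hW hW1
  rw [hmt] at herr
  refine ⟨W', hsupp, herr.trans_eq ?_⟩
  calc (m : ℝ) * (3 * gTilde h k J₀ lam g * γ / (α - D) * Δt *
        (((m * δ : ℕ) : ℝ) ^ (((D : ℝ) - 1) / 2) * (δ : ℝ) ^ (-α + ((D : ℝ) + 1) / 2)))
      = 3 * gTilde h k J₀ lam g * γ / (α - D) * (t * (((m * δ : ℕ) : ℝ) ^ (((D : ℝ) - 1) / 2) *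
          ((m * δ : ℕ) * Δt / t) ^ (-α + ((D : ℝ) + 1) / 2))) := by
        rw [← hδ, ← hmt]
        ring
    _ = _ := by
        rw [mul_rpow_mul_rpow_div_eq (by exact_mod_cast hR) hΔ.le ht]
        ring

lemma three_mul_div_le_C₀ (hD : 1 ≤ D) (hα : (D : ℝ) < α) (hγ : 1 ≤ γ) (hJ : 0 ≤ J₀) {gt : ℝ}
    (hgt : 0 ≤ gt) : 3 * gt * γ / (α - D) ≤ 2 ^ (D - 1) * C₀ D α γ J₀ gt := by
  have hD' : (1 : ℝ) ≤ D := by exact_mod_cast hD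
  have : 0 < α - D := sub_pos.2 hα
  have hpow : 1 ≤ (2 : ℝ) ^ (α - (D : ℝ) / 2) := Real.one_le_rpow one_le_two (by linarith)
  have hsqrt : 1 ≤ √(2 * α - 2 * D + γ) := Real.one_le_sqrt.2 (by linarith)
  have hfirst : 0 ≤ (2 : ℝ) ^ (α - (D : ℝ) / 2 + 2) * J₀ * γ / (2 * α - D - 1) :=
    div_nonneg (by positivity) (by linarith)
  calc 3 * gt * γ / (α - D)
      = 1 * (0 + 3 * gt * γ * 1 / (α - D) * 1) := by ring
    _ ≤ 2 ^ (D - 1) * C₀ D α γ J₀ gt := by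
        rw [C₀]
        gcongr
        · exact one_le_pow₀ one_le_two
        · norm_num

end Approximation

section Otoc

variable {Λ : Type*} [Fintype Λ] [DecidableEq Λ] {G : SimpleGraph Λ} {H V W W' : Op Λ} {t : ℝ}

lemma otoc_eq_frobNorm_sq (H W V : Op Λ) (t : ℝ) :
    otoc H t W V = frobNorm ⁅evolve H t W, V⁆ ^ 2 := by
  rw [frobNorm_eq_norm_pauliVec, ← inner_self_eq_norm_sq (𝕜 := ℂ), inner_pauliVec]
  rfl

lemma otoc_le_of_commute (hV : opNorm V ≤ 1) (hcomm : Commute W' V) :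
    otoc H t W V ≤ 4 * frobNorm (evolve H t W - W') ^ 2 := by
  have hlie : ⁅evolve H t W, V⁆ = ⁅evolve H t W - W', V⁆ := by
    rw [sub_lie, hcomm.lie_eq, sub_zero]
  have hnorm : frobNorm ⁅evolve H t W, V⁆ ≤ 2 * frobNorm (evolve H t W - W') := by
    rw [hlie]
    exact (frobNorm_lie_le _ V).trans
      (mul_le_of_le_one_right (mul_nonneg zero_le_two (frobNorm_nonneg _)) hV)
  calc otoc H t W V = frobNorm ⁅evolve H t W, V⁆ ^ 2 := otoc_eq_frobNorm_sq H W V t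
    _ ≤ (2 * frobNorm (evolve H t W - W')) ^ 2 := pow_le_pow_left₀ (frobNorm_nonneg _) hnorm 2
    _ = 4 * frobNorm (evolve H t W - W') ^ 2 := by ring

lemma otoc_le_of_supportedOn_ball {i i' : Λ} {r : ℕ} (hr : r < G.dist i i')
    (hV : SupportedOn {i'} V) (hV1 : opNorm V ≤ 1) (hW' : SupportedOn (ball G i r) W') :
    otoc H t W V ≤ 4 * frobNorm (evolve H t W - W') ^ 2 :=
  otoc_le_of_commute hV1 (hW'.commute hV (by simpa [mem_ball] using hr))

lemma frobNorm_evolve_le_one (hH : H.IsHermitian) (hW : opNorm W ≤ 1) (t : ℝ) :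
    frobNorm (evolve H t W) ≤ 1 :=
  (frobNorm_evolve_le hH t W).trans ((frobNorm_le_opNorm W).trans hW)

lemma otoc_le_four (hH : H.IsHermitian) (hW : opNorm W ≤ 1) (hV : opNorm V ≤ 1) :
    otoc H t W V ≤ 4 := by
  have hle := otoc_le_of_commute (H := H) (W := W) (t := t) hV (Commute.zero_left V)
  rw [sub_zero] at hle
  exact hle.trans (mul_le_of_le_one_right zero_le_four
    (pow_le_one₀ (frobNorm_nonneg _) (frobNorm_evolve_le_one hH hW t)))

/-- The bound `otoc ≤ 4` turns the quadratic estimate into a linear one, so that the OTOC decays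
with the same power as the approximation error. -/
lemma otoc_le_mul_rpow_mul_rpow (hH : H.IsHermitian) {d α C t₀ : ℝ} (hdα : d ≤ α)
    (hy : 0 ≤ α - (d - 1) / 2) (hC : 0 ≤ C) (ht₀ : 0 < t₀) (ht : t₀ ≤ t) {i i' : Λ} {R : ℕ}
    (hR : 1 ≤ R) (hdist : G.dist i i' = R) (hW : opNorm W ≤ 1) (hV : SupportedOn {i'} V)
    (hV1 : opNorm V ≤ 1)
    (happrox : ∀ r : ℕ, 1 ≤ r → ∃ W' : Op Λ, SupportedOn (ball G i r) W' ∧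
      frobNorm (evolve H t W - W') ≤ C * (r : ℝ) ^ (-α + d) * t ^ (α - (d - 1) / 2)) :
    otoc H t W V ≤ (4 * C * 2 ^ (α - d) + 4 * t₀ ^ (-(α - (d - 1) / 2))) *
      t ^ (α - (d - 1) / 2) * (R : ℝ) ^ (-α + d) := by
  set y := α - (d - 1) / 2
  have ht' : 0 < t := ht₀.trans_le ht
  have hfour : otoc H t W V ≤ 4 := otoc_le_four hH hW hV1
  rcases hR.eq_or_lt with rfl | hR2
  · calc otoc H t W V ≤ 4 * 1 := by linarith
      _ ≤ 4 * (t₀ ^ (-y) * t ^ y) := by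
          rw [Real.rpow_neg ht₀.le, ← div_eq_inv_mul]
          gcongr
          exact (one_le_div (by positivity)).2 (Real.rpow_le_rpow ht₀.le ht hy)
      _ ≤ (4 * C * 2 ^ (α - d) + 4 * t₀ ^ (-y)) * t ^ y * ((1 : ℕ) : ℝ) ^ (-α + d) := by
          rw [Nat.cast_one, Real.one_rpow, mul_one, add_mul, ← mul_assoc]
          exact le_add_of_nonneg_left (by positivity)
  · obtain ⟨W', hW', herr⟩ := happrox (R - 1) (by omega)
    set F := frobNorm (evolve H t W - W')
    have hF : 0 ≤ F := frobNorm_nonneg _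
    have hquad : otoc H t W V ≤ 4 * F ^ 2 :=
      otoc_le_of_supportedOn_ball (by omega : R - 1 < G.dist i i') hV hV1 hW'
    have hlin : otoc H t W V ≤ 4 * F := by
      rcases le_total F 1 with hF1 | hF1 <;> nlinarith
    have hhalf : (R : ℝ) ≤ 2 * (R - 1 : ℕ) := by exact_mod_cast (by omega : R ≤ 2 * (R - 1))
    have hpow := rpow_neg_le_two_rpow_mul (by positivity) (sub_nonneg.2 hdα) hhalf
    rw [show -(α - d) = -α + d by ring] at hpow
    calc otoc H t W V ≤ 4 * (C * ((R - 1 : ℕ) : ℝ) ^ (-α + d) * t ^ y) := by linarith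
      _ ≤ 4 * (C * (2 ^ (α - d) * (R : ℝ) ^ (-α + d)) * t ^ y) := by gcongr
      _ = 4 * C * 2 ^ (α - d) * t ^ y * (R : ℝ) ^ (-α + d) := by ring
      _ ≤ (4 * C * 2 ^ (α - d) + 4 * t₀ ^ (-y)) * t ^ y * (R : ℝ) ^ (-α + d) := by
          gcongr
          exact le_add_of_nonneg_right (by positivity)

lemma mul_rpow_mul_rpow_eq_rpow {K t R α d : ℝ} (hK : 0 ≤ K) (ht : 0 ≤ t) (hR : 0 ≤ R)
    (hy : 0 < α - (d - 1) / 2) :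
    K * t ^ (α - (d - 1) / 2) * R ^ (-α + d) =
      (K ^ (1 / (α - (d - 1) / 2)) * t / R ^ ((2 * α - 2 * d) / (2 * α - d + 1))) ^
        (α - (d - 1) / 2) := by
  have hexp : (2 * α - 2 * d) / (2 * α - d + 1) * (α - (d - 1) / 2) = -(-α + d) := by
    rw [div_mul_eq_mul_div, div_eq_iff (by linarith)]
    ring
  rw [Real.div_rpow (by positivity) (by positivity), Real.mul_rpow (by positivity) ht,
    ← Real.rpow_mul hK, ← Real.rpow_mul hR, one_div_mul_cancel hy.ne', Real.rpow_one, hexp,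
    Real.rpow_neg hR, div_inv_eq_mul]

end Otoc

section Uniform

/-- A bound for `g̃` that depends on the system only through `k`, `J₀` and `λ`: the constant
`4 ^ (k / 2) * J₀` bounds `J` as well as the one-site energies. -/
def gTildeBound (k : ℕ) (J₀ lam : ℝ) : ℝ :=
  max (4 ^ ((k : ℝ) / 2) * J₀ * k) (lam * (4 ^ ((k : ℝ) / 2) * J₀))

lemma pauliBase_rpow_le {Λ : Type*} [Fintype Λ] (h : Finset Λ → Op Λ) {s : ℝ} (hs : 0 ≤ s) :
    pauliBase h ^ s ≤ 4 ^ s :=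
  Real.rpow_le_rpow (zero_le_one.trans (one_le_pauliBase h)) (pauliBase_le h) hs

lemma exists_dvd_le_two_mul {m r : ℕ} (hm : 0 < m) (hmr : m ≤ r) :
    ∃ R, 0 < R ∧ m ∣ R ∧ R ≤ r ∧ r ≤ 2 * R := by
  have hdiv : 1 ≤ r / m := (Nat.one_le_div_iff hm).2 hmr
  have hle : m ≤ m * (r / m) := Nat.le_mul_of_pos_right m hdiv
  have hlt : r < m * (r / m) + m := Nat.lt_mul_div_succ r hm
  exact ⟨m * (r / m), by omega, dvd_mul_right _ _, Nat.mul_div_le r m, by omega⟩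

lemma exists_mul_div_le_one {K t₀ t : ℝ} (hK : 0 < K) (ht₀ : 0 < t₀) (ht : t₀ ≤ t) :
    ∃ m : ℕ, 0 < m ∧ K * (t / m) ≤ 1 ∧ (K + t₀⁻¹)⁻¹ ≤ t / m := by
  have ht' : 0 < t := ht₀.trans_le ht
  have hm : 0 < ⌈K * t⌉₊ := Nat.ceil_pos.2 (by positivity)
  refine ⟨⌈K * t⌉₊, hm, ?_, ?_⟩
  · rw [mul_div_assoc', div_le_one (by exact_mod_cast hm)]
    exact Nat.le_ceil _
  · rw [inv_le_comm₀ (by positivity) (by positivity), inv_div, div_le_iff₀ ht', add_mul]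
    have hone : 1 ≤ t₀⁻¹ * t := by rwa [← div_eq_inv_mul, one_le_div ht₀]
    linarith [Nat.ceil_lt_add_one (mul_pos hK ht').le]

lemma one_le_mul_rpow_mul_rpow {α d ε t₀ t r : ℝ} (hd : -1 ≤ d) (hdα : d ≤ α) (hε : 0 < ε)
    (ht₀ : 0 < t₀) (ht : t₀ ≤ t) (hr : 0 < r) (hrt : r ≤ t / ε) :
    1 ≤ ε ^ (-(α - d)) * t₀ ^ (-((d + 1) / 2)) * r ^ (-α + d) * t ^ (α - (d - 1) / 2) := by
  have ht' : 0 < t := ht₀.trans_le ht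
  have hsplit : t ^ (α - (d - 1) / 2) = t ^ (α - d) * t ^ ((d + 1) / 2) := by
    rw [← Real.rpow_add ht']
    ring_nf
  have hspace : 1 ≤ ε ^ (-(α - d)) * r ^ (-α + d) * t ^ (α - d) := by
    rw [show -α + d = -(α - d) by ring, ← Real.mul_rpow hε.le hr.le, Real.rpow_neg (by positivity),
      ← div_eq_inv_mul, one_le_div (by positivity)]
    refine Real.rpow_le_rpow (by positivity) ?_ (sub_nonneg.2 hdα)
    rwa [mul_comm, ← le_div_iff₀ hε]
  have htime : 1 ≤ t₀ ^ (-((d + 1) / 2)) * t ^ ((d + 1) / 2) := by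
    rw [Real.rpow_neg ht₀.le, ← div_eq_inv_mul, one_le_div (by positivity)]
    exact Real.rpow_le_rpow ht₀.le ht (by linarith)
  calc 1 ≤ ε ^ (-(α - d)) * r ^ (-α + d) * t ^ (α - d) *
        (t₀ ^ (-((d + 1) / 2)) * t ^ ((d + 1) / 2)) := one_le_mul_of_one_le_of_one_le hspace htime
    _ = _ := by
        rw [hsplit]
        ring

variable {Λ : Type*} [Fintype Λ] [DecidableEq Λ] {G : SimpleGraph Λ} {h : Finset Λ → Op Λ}
  {W : Op Λ} {D k : ℕ} {α γ J₀ lam g t : ℝ}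

lemma IsPowerLaw.isSiteEnergy (hP : IsPowerLaw G h k α J₀) :
    IsSiteEnergy h (4 ^ ((k : ℝ) / 2) * J₀) := by
  intro i
  have hdecay : ∑ Z with i ∈ Z, opNorm (h Z) ≤ J₀ := by simpa using hP.decay i i
  calc ∑ Z with i ∈ Z, ∑ p with p i ≠ 0, ‖pauliCoeff p (h Z)‖
      ≤ ∑ Z with i ∈ Z, 4 ^ ((k : ℝ) / 2) * opNorm (h Z) := by
        refine sum_le_sum fun Z _ => ?_
        calc ∑ p with p i ≠ 0, ‖pauliCoeff p (h Z)‖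
            ≤ ∑ p, ‖pauliCoeff p (h Z)‖ :=
              sum_le_univ_sum_of_nonneg fun _ => norm_nonneg _
          _ ≤ pauliBase h ^ ((k : ℝ) / 2) * opNorm (h Z) := hP.sum_norm_pauliCoeff_le Z
          _ ≤ 4 ^ ((k : ℝ) / 2) * opNorm (h Z) :=
              mul_le_mul_of_nonneg_right (pauliBase_rpow_le h (by positivity)) (opNorm_nonneg _)
    _ ≤ 4 ^ ((k : ℝ) / 2) * J₀ := by
        rw [← mul_sum]
        gcongr

lemma IsPowerLaw.gTilde_le_gTildeBound [Nonempty Λ] (hP : IsPowerLaw G h k α J₀)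
    (hl : IsConvConst G α lam) :
    gTilde h k J₀ lam (4 ^ ((k : ℝ) / 2) * J₀) ≤ gTildeBound k J₀ lam := by
  have hJ := hP.nonneg
  have hlam := zero_le_one.trans hl.one_le
  exact max_le_max le_rfl (mul_le_mul_of_nonneg_left
    (mul_le_mul_of_nonneg_right (pauliBase_rpow_le h (by positivity)) hJ) hlam)

lemma IsPowerLaw.exists_local_approximation_of_le (hP : IsPowerLaw G h k α J₀)
    (hl : IsConvConst G α lam) (hg : IsSiteEnergy h g) (hG : IsLattice G D γ) (hD : 1 ≤ D)
    (hα : (D : ℝ) < α) {M ε : ℝ} {m r : ℕ} (hM : gTilde h k J₀ lam g ≤ M) (ht : 0 < t)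
    (hm : 0 < m) (hsmall : 2 * Real.exp 1 * gTilde h k J₀ lam g * (t / m) < 1) (hε : 0 < ε)
    (hεm : ε ≤ t / m) (hmr : m ≤ r) {i : Λ} (hW : SupportedOn {i} W) (hW1 : opNorm W ≤ 1) :
    ∃ W' : Op Λ, SupportedOn (ball G i r) W' ∧
      frobNorm (evolve (hamiltonian h) t W - W') ≤
        3 * M * γ / (α - D) * ε ^ (-α + ((D : ℝ) + 1) / 2) * 2 ^ (α - D) * (r : ℝ) ^ (-α + D) *
          t ^ (α - ((D : ℝ) - 1) / 2) := by
  have : Nonempty Λ := ⟨i⟩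
  have hD' : (1 : ℝ) ≤ D := by exact_mod_cast hD
  have hγ : 0 ≤ γ := zero_le_one.trans hG.one_le
  have hαD : 0 < α - D := sub_pos.2 hα
  have hM0 : 0 ≤ M := (hP.gTilde_nonneg hl g).trans hM
  obtain ⟨R, hR, hmR, hRr, hrR⟩ := exists_dvd_le_two_mul hm hmr
  have hm' : (0 : ℝ) < m := by exact_mod_cast hm
  have hr' : (0 : ℝ) < r := by exact_mod_cast hR.trans_le hRr
  obtain ⟨W', hW', herr⟩ := hP.exists_local_approximation hl hg hG hD hα ht (div_pos ht hm') hsmall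
    (div_div_cancel₀ ht.ne') hR hmR hW hW1
  have htime : (t / m) ^ (-α + ((D : ℝ) + 1) / 2) ≤ ε ^ (-α + ((D : ℝ) + 1) / 2) :=
    Real.rpow_le_rpow_of_nonpos hε hεm (by linarith)
  have hradius : (R : ℝ) ^ (-α + (D : ℝ)) ≤ 2 ^ (α - D) * (r : ℝ) ^ (-α + (D : ℝ)) := by
    rw [show -α + (D : ℝ) = -(α - D) by ring]
    exact rpow_neg_le_two_rpow_mul hr' hαD.le (by exact_mod_cast hrR)
  refine ⟨W', hW'.mono (ball_mono i hRr), herr.trans ?_⟩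
  calc 3 * gTilde h k J₀ lam g * γ / (α - D) * (t / m) ^ (-α + ((D : ℝ) + 1) / 2) *
        t ^ (α - ((D : ℝ) - 1) / 2) * (R : ℝ) ^ (-α + D)
      ≤ 3 * M * γ / (α - D) * ε ^ (-α + ((D : ℝ) + 1) / 2) * t ^ (α - ((D : ℝ) - 1) / 2) *
          (2 ^ (α - D) * (r : ℝ) ^ (-α + D)) := by gcongr
    _ = _ := by ring

/-- With steps of length between `ε` and `1 / K` the constants are uniform; radii smaller than the
number of steps are reached by the zero operator, at the price of the constant `C₂`. -/
lemma exists_uniform_local_approximation (D k : ℕ) (hD : 1 ≤ D) (α γ J₀ : ℝ) (hα : (D : ℝ) < α)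
    {t₀ : ℝ} (ht₀ : 0 < t₀) : ∃ C : ℝ, 0 < C ∧
      ∀ (Λ : Type u) [Fintype Λ] [DecidableEq Λ] (G : SimpleGraph Λ) (h : Finset Λ → Op Λ),
      IsLattice G D γ → IsPowerLaw G h k α J₀ →
      ∀ t : ℝ, t₀ ≤ t → ∀ (i : Λ) (W : Op Λ), SupportedOn {i} W → opNorm W ≤ 1 →
        ∀ r : ℕ, 1 ≤ r → ∃ W' : Op Λ, SupportedOn (ball G i r) W' ∧
          frobNorm (evolve (hamiltonian h) t W - W') ≤
            C * (r : ℝ) ^ (-α + D) * t ^ (α - ((D : ℝ) - 1) / 2) := by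
  set M := gTildeBound k J₀ (convConst D α γ)
  set K := 2 * Real.exp 1 * (|M| + 1)
  set ε := (K + t₀⁻¹)⁻¹
  have hK : 0 < K := by positivity
  have hε : 0 < ε := by positivity
  set C₁ := 3 * M * γ / (α - D) * ε ^ (-α + ((D : ℝ) + 1) / 2) * 2 ^ (α - D)
  set C₂ := ε ^ (-(α - D)) * t₀ ^ (-(((D : ℝ) + 1) / 2))
  refine ⟨|C₁| + C₂, by positivity, fun Λ _ _ G h hG hP t ht i W hW hW1 r hr => ?_⟩
  have : Nonempty Λ := ⟨i⟩
  have hl := hG.isConvConst hD hα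
  have hM := hP.gTilde_le_gTildeBound hl
  have ht' : 0 < t := ht₀.trans_le ht
  obtain ⟨m, hm, hKm, hεm⟩ := exists_mul_div_le_one hK ht₀ ht
  have hm' : (0 : ℝ) < m := by exact_mod_cast hm
  rcases le_or_gt m r with hmr | hrm
  · have hsmall : 2 * Real.exp 1 * gTilde h k J₀ (convConst D α γ) (4 ^ ((k : ℝ) / 2) * J₀) *
        (t / m) < 1 := by
      refine lt_of_lt_of_le (mul_lt_mul_of_pos_right (mul_lt_mul_of_pos_left ?_ (by positivity))
        (div_pos ht' hm')) hKm
      exact (hM.trans (le_abs_self M)).trans_lt (lt_add_one _)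
    obtain ⟨W', hW', herr⟩ := hP.exists_local_approximation_of_le hl hP.isSiteEnergy hG hD hα hM ht'
      hm hsmall hε hεm hmr hW hW1
    refine ⟨W', hW', herr.trans ?_⟩
    gcongr
    exact (le_abs_self C₁).trans (le_add_of_nonneg_right (by positivity))
  · refine ⟨0, supportedOn_zero _, ?_⟩
    have hrt : (r : ℝ) ≤ t / ε := by
      rw [le_div_iff₀ hm', mul_comm, ← le_div_iff₀ hε] at hεm
      exact (by exact_mod_cast hrm.le : (r : ℝ) ≤ m).trans hεm
    calc frobNorm (evolve (hamiltonian h) t W - 0)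
        ≤ 1 := by simpa using frobNorm_evolve_le_one hP.isHermitian_hamiltonian hW1 t
      _ ≤ C₂ * (r : ℝ) ^ (-α + D) * t ^ (α - ((D : ℝ) - 1) / 2) :=
          one_le_mul_rpow_mul_rpow (by linarith [(Nat.cast_nonneg D : (0 : ℝ) ≤ D)]) hα.le hε ht₀ ht
            (by exact_mod_cast hr) hrt
      _ ≤ (|C₁| + C₂) * (r : ℝ) ^ (-α + D) * t ^ (α - ((D : ℝ) - 1) / 2) := by
          gcongr
          exact le_add_of_nonneg_left (abs_nonneg _)

end Uniform

end LongRange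

end

theorem theorem1 (D k : ℕ) (hD : 1 ≤ D) (α γ J₀ : ℝ) (hα : (D : ℝ) < α) :
    -- the local approximation, with explicit constants
    (∀ (Λ : Type u) [Fintype Λ] [DecidableEq Λ] (G : SimpleGraph Λ) (h : Finset Λ → Op Λ),
      IsLattice G D γ → IsPowerLaw G h k α J₀ →
      ∀ lam g : ℝ, IsConvConst G α lam → IsSiteEnergy h g →
      ∀ (t Δt : ℝ) (m R : ℕ), 0 < t → 0 < Δt → 2 * Real.exp 1 * gTilde h k J₀ lam g * Δt < 1 →
        t / Δt = m → 0 < R → m ∣ R →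
      ∀ (i : Λ) (W : Op Λ), SupportedOn {i} W → opNorm W = 1 →
      ∃ W' : Op Λ, SupportedOn (ball G i R) W' ∧
        frobNorm (evolve (hamiltonian h) t W - W') ≤
          (2 : ℝ) ^ (D - 1) * C₀ D α γ J₀ (gTilde h k J₀ lam g)
            * Δt ^ (-α + ((D : ℝ) + 1) / 2) * t ^ (α - ((D : ℝ) - 1) / 2)
            * (R : ℝ) ^ (-α + D)) ∧
    -- the OTOC is controlled by the error of any local approximation
    (∀ (Λ : Type u) [Fintype Λ] [DecidableEq Λ] (G : SimpleGraph Λ) (h : Finset Λ → Op Λ),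
      IsLattice G D γ → IsPowerLaw G h k α J₀ →
      ∀ (t : ℝ) (i i' : Λ) (R : ℕ), 1 ≤ R → G.dist i i' = R →
      ∀ W V W' : Op Λ, SupportedOn {i} W → opNorm W = 1 → SupportedOn {i'} V → opNorm V = 1 →
        SupportedOn (ball G i (R - 1)) W' →
        otoc (hamiltonian h) t W V ≤ 4 * frobNorm (evolve (hamiltonian h) t W - W') ^ 2) ∧
    -- the local approximation at all radii, and the polynomial growth of the OTOC, for times
    -- bounded away from zero, with constants that do not depend on the system
    (∀ t₀ : ℝ, 0 < t₀ → ∃ C C' : ℝ, 0 < C ∧ 0 < C' ∧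
      ∀ (Λ : Type u) [Fintype Λ] [DecidableEq Λ] (G : SimpleGraph Λ) (h : Finset Λ → Op Λ),
      IsLattice G D γ → IsPowerLaw G h k α J₀ →
      ∀ t : ℝ, t₀ ≤ t → ∀ (i : Λ) (W : Op Λ), SupportedOn {i} W → opNorm W = 1 →
        (∀ r : ℕ, 1 ≤ r → ∃ W' : Op Λ, SupportedOn (ball G i r) W' ∧
          frobNorm (evolve (hamiltonian h) t W - W') ≤
            C * (r : ℝ) ^ (-α + D) * t ^ (α - ((D : ℝ) - 1) / 2)) ∧
        (∀ (i' : Λ) (R : ℕ), 1 ≤ R → G.dist i i' = R →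
          ∀ V : Op Λ, SupportedOn {i'} V → opNorm V = 1 →
          otoc (hamiltonian h) t W V ≤
            (C' * t / (R : ℝ) ^ ((2 * α - 2 * D) / (2 * α - D + 1)))
              ^ (α - ((D : ℝ) - 1) / 2))) := by
  refine ⟨?_, ?_, fun t₀ ht₀ => ?_⟩
  · intro Λ _ _ G h hG hP lam g hl hg t Δt m R ht hΔ hsmall hm hR hmR i W hW hW1
    have : Nonempty Λ := ⟨i⟩
    obtain ⟨W', hW', herr⟩ :=
      hP.exists_local_approximation hl hg hG hD hα ht hΔ hsmall hm hR hmR hW hW1.le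
    refine ⟨W', hW', herr.trans ?_⟩
    have hC₀ := three_mul_div_le_C₀ hD hα hG.one_le hP.nonneg (hP.gTilde_nonneg hl g)
    gcongr
  · intro Λ _ _ G h _ _ t i i' R hR hdist W V W' _ _ hV hV1 hW'
    exact otoc_le_of_supportedOn_ball (by omega) hV hV1.le hW'
  · have hy : 0 < α - ((D : ℝ) - 1) / 2 := by
      linarith [(Nat.cast_nonneg D : (0 : ℝ) ≤ D)]
    obtain ⟨C, hC, happrox⟩ := exists_uniform_local_approximation.{u} D k hD α γ J₀ hα ht₀
    set K := 4 * C * 2 ^ (α - D) + 4 * t₀ ^ (-(α - ((D : ℝ) - 1) / 2))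
    refine ⟨C, K ^ (1 / (α - ((D : ℝ) - 1) / 2)), hC, by positivity,
      fun Λ _ _ G h hG hP t ht i W hW hW1 => ?_⟩
    have hlocal := happrox Λ G h hG hP t ht i W hW hW1.le
    refine ⟨hlocal, fun i' R hR hdist V hV hV1 => ?_⟩
    rw [← mul_rpow_mul_rpow_eq_rpow (by positivity) (ht₀.le.trans ht) (Nat.cast_nonneg R) hy]
    exact otoc_le_mul_rpow_mul_rpow hP.isHermitian_hamiltonian hα.le hy.le hC.le ht₀ ht hR hdist
      hW1.le hV hV1.le hlocal
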